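/- Let $D_n=\sum_{k=0}^n\binom nk\binom{n+k}k$ be the (central) Delannoy numbers and $S_n=\sum_{k=0}^n\binom nk\binom{n+k}k\frac1{k+1}$ the (large) Schröder numbers. Let $B_n$ be the Bernoulli numbers, given by $\frac{x}{e^x-1}=\sum_{n\ge 0}B_n\frac{x^n}{n!}$, and let $H^{*}_n=\sum_{k=1}^n\frac{(-1)^k}{k}$. For a prime $p$ and rational numbers $x,y$, write $x\equiv y\pmod{p^4}$ if $x-y=p^4z$ for some rational number $z$ whose reduced denominator is not divisible by $p$. Then for every prime $p>3$, $$\sum_{k=1}^{p-1}D_kS_k\equiv 2p^3B_{p-3}-2pH^{*}_{p-1}\pmod{p^4}.$$ Moreover, for every prime $p>3$ this congruence is equivalent to the one conjectured by Z.-W. Sun in 2011, $$\sum_{k=1}^{p-1}D_kS_k\equiv -2p\sum_{k=1}^{p-1}\frac{(-1)^k+3}{k}\pmod{p^4}.$$ -/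

import Mathlib

/-- The central Delannoy number `D_n = ∑_{k=0}^n C(n,k) C(n+k,k)`. -/
def delannoyNumber (n : ℕ) : ℕ :=
  ∑ k ∈ Finset.range (n + 1), n.choose k * (n + k).choose k

/-- The (large) Schröder number `S_n = ∑_{k=0}^n C(n,k) C(n+k,k) / (k+1)`, as a rational number. -/
def schroderNumber (n : ℕ) : ℚ :=
  ∑ k ∈ Finset.range (n + 1), (n.choose k : ℚ) * ((n + k).choose k : ℚ) * (1 / ((k : ℚ) + 1))

/-- The alternating harmonic number `H*_n = ∑_{k=1}^n (-1)^k / k`. -/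
def altHarmonic (n : ℕ) : ℚ :=
  ∑ k ∈ Finset.Icc 1 n, (-1 : ℚ) ^ k / (k : ℚ)

/-- Congruence of rational numbers modulo `m`: the difference is `m` times a rational number
whose reduced denominator is prime to `m`. For `m = p ^ r` with `p` prime and `r ≥ 1` this is
congruence modulo `p ^ r` in the ring of `p`-integral rational numbers. -/
def RatModEq (m : ℕ) (x y : ℚ) : Prop :=
  ∃ z : ℚ, Nat.Coprime z.den m ∧ x - y = (m : ℚ) * z

/-!
The idea is to write the sum as the integral over `[0, 1]` of one polynomial in `w = x + x²`, and to
compare that polynomial with the Catalan generating function, which is elementary in `x`.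

Let `F = ∫₀ˣ D_n` with `D_n` the Delannoy polynomial, so that `F(1) = S_n` and `F'(1)` is the
Delannoy number. Legendre's equation gives `w F'' = n(n+1) F`. Hence `F²` satisfies a third order
equation that is symmetric under `x ↦ -1 - x`, and comparing solutions (`eq_zero_of_ode`) shows that
`F²` is an explicit polynomial in `w` for `n ≥ 1`. Thus
`(F F')' = ∑ C(n+k,2k) C(2k,k) C(2k+1,k+1) w^k`, and `D_n S_n` is the integral of this polynomial.
The sum over `n < p` is a hockey-stick sum and gives (`sum_delannoy_mul_schroder`)
`∑_{n<p} D_n S_n = p ∫₀¹ ∑_{k<p} (-1)^k A_k Cat_k w^k`, with `A_k = ∏_{i≤k} (1 - p²/i²)`.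

Modulo `p⁴` one may replace `A_k` by `1 - p² H_k^{(2)}`. The series `∑ (-1)^k Cat_k w^k` is
`1 / (1 + x)`, and the one weighted by `H_k^{(2)}` has the coefficients
`2 (-1)^m (H_m^{(2)} - H_m / (m+1))`. Both follow from `derivative_derivative_quad_mul_catalanPoly`:
multiplying by `w` and differentiating twice replaces the weights by their differences. The same
identity determines the coefficients that the truncation at `k < p` changes, namely those of degree
at least `p` (`coeff_catalanPoly_one_add_mem`, `coeff_catalanPoly_genHarmonic_two_mem`). Integrating
term by term, where `1/p` occurs only in degree `p - 1`, one finds modulo `p⁴`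
`1 - 2p H* + 3p² H*^{(2)} - 5p³ H*^{(3)} + 4p³ W - 2p² H^{(2)} + 2p H`,
with (alternating) harmonic numbers of index `p - 1` and a double sum `W` that is odd under
`k ↦ p - k` and so vanishes modulo `p` (`alt_double_sum_mem`).

The reflection `k ↦ p - k`, combined with a comparison of the sums over `k ≤ p/2` and over even `k`
(`doubling_mem`), expresses all remaining harmonic numbers through `p² H^{(2)}`, and the total
becomes `1 - 2p H* + 3p² H^{(2)}`. Finally `3 H^{(2)} ≡ 2p B_{p-3}` modulo `p²`: the doubling
argument applies equally to the exponents `-2` and `p - 3`, and Faulhaber's formula evaluates the sum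
for the latter. Since `-6p H ≡ 3p² H^{(2)} ≡ 2p³ B_{p-3}` modulo `p⁴`, the two right hand sides agree.
-/

section Polynomials

open Polynomial

/-! ### Polynomials in `x + x²` and their integrals -/

/-- The quadratic `x + x²`. -/
noncomputable def quad : ℚ[X] := X + X ^ 2

/-- The linear functional `P ↦ ∫₀¹ P`. -/
noncomputable def integ : ℚ[X] →ₗ[ℚ] ℚ :=
  Polynomial.lsum fun m => ((1 : ℚ) / (m + 1)) • LinearMap.id

theorem integ_monomial (m : ℕ) (a : ℚ) : integ (monomial m a) = a / (m + 1) := by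
  simp [integ, Polynomial.lsum_apply, sum_monomial_index]
  ring

theorem integ_eq_sum_range (P : ℚ[X]) (N : ℕ) (h : P.natDegree < N) :
    integ P = ∑ m ∈ Finset.range N, P.coeff m / (m + 1) := by
  conv_lhs => rw [P.as_sum_range' N h]
  rw [map_sum]
  exact Finset.sum_congr rfl fun m _ => integ_monomial m _

theorem integ_derivative (P : ℚ[X]) : integ (derivative P) = P.eval 1 - P.eval 0 := by
  induction P using Polynomial.induction_on' with
  | add p q hp hq => simp only [map_add, hp, hq, eval_add]; ring
  | monomial n a =>
    rw [derivative_monomial, integ_monomial]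
    rcases n with _ | n
    · simp
    · simp
      field_simp

theorem coeff_quad_pow (j m : ℕ) :
    (quad ^ j).coeff m = if j ≤ m then (j.choose (m - j) : ℚ) else 0 := by
  have : quad ^ j = X ^ j * (1 + X) ^ j := by rw [quad, ← mul_pow]; ring
  rw [this, coeff_X_pow_mul', coeff_one_add_X_pow]

theorem natDegree_quad_pow_le (j : ℕ) : (quad ^ j).natDegree ≤ 2 * j := by
  have h : quad.natDegree ≤ 2 := by unfold quad; compute_degree
  calc _ ≤ j * quad.natDegree := natDegree_pow_le
    _ ≤ 2 * j := by nlinarith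

theorem derivative_quad : derivative quad = 1 + 2 * X := by
  simp [quad, map_ofNat C 2, one_add_one_eq_two]

theorem derivative_quad_sq : (1 + 2 * X : ℚ[X]) ^ 2 = 1 + 4 * quad := by
  unfold quad; ring

/-- The ratio of consecutive binomial coefficients along the direction `(1, 2)`. -/
theorem choose_add_two_mul (m j : ℕ) :
    ((m + 1).choose (j + 2) : ℚ) * ((j + 2) * (j + 1)) = m.choose j * ((m + 1) * (m - j)) := by
  have h1 : ((m + 1).choose (j + 2) : ℚ) * (j + 2) = (m + 1) * m.choose (j + 1) := by
    have := Nat.add_one_mul_choose_eq m (j + 1)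
    have h : ((m + 1) * m.choose (j + 1) : ℚ) = (m + 1).choose (j + 2) * (j + 1 + 1) := by
      exact_mod_cast this
    rw [h]; ring
  have h2 : (m.choose (j + 1) : ℚ) * (j + 1) = m.choose j * (m - j) := by
    rcases le_or_gt j m with h | h
    · have := Nat.choose_succ_right_eq m j
      rw [← Nat.cast_sub h]
      exact_mod_cast this
    · rw [Nat.choose_eq_zero_of_lt h, Nat.choose_eq_zero_of_lt (by omega)]; simp
  linear_combination (j + 1 : ℚ) * h1 + (m + 1 : ℚ) * h2

theorem centralBinom_succ_cast (k : ℕ) :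
    ((k + 1).centralBinom : ℚ) * (k + 1) = 2 * (2 * k + 1) * k.centralBinom := by
  have := Nat.succ_mul_centralBinom_succ k
  have h : ((k + 1 : ℚ) * (k + 1).centralBinom) = 2 * (2 * k + 1) * k.centralBinom := by
    exact_mod_cast this
  linear_combination h

/-- The second derivative of a polynomial in `x + x²`, again expanded in powers of `x + x²`. -/
theorem derivative_derivative_sum_quad (K : ℕ) (b : ℕ → ℚ) :
    derivative (derivative (∑ k ∈ Finset.range (K + 1), C (b k) * quad ^ (k + 1))) =
      ∑ k ∈ Finset.range K,
        C (2 * (k + 1) * (2 * k + 1) * b k + (k + 2) * (k + 1) * b (k + 1)) * quad ^ k +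
      C (2 * (K + 1) * (2 * K + 1) * b K) * quad ^ K := by
  induction K with
  | zero =>
    simp [derivative_quad, map_ofNat C 2]
    ring
  | succ K ih =>
    rw [Finset.sum_range_succ, derivative_add, derivative_add, ih, Finset.sum_range_succ]
    have : derivative (derivative (C (b (K + 1)) * quad ^ (K + 1 + 1))) =
        C ((K + 2) * (K + 1) * b (K + 1)) * quad ^ K +
        C (2 * (K + 2) * (2 * K + 3) * b (K + 1)) * quad ^ (K + 1) := by
      simp only [derivative_mul, derivative_C, derivative_pow, derivative_quad, map_mul, map_add,
        map_natCast, map_ofNat, zero_mul, zero_add, derivative_one,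
        derivative_X, Nat.add_sub_cancel, mul_one, derivative_ofNat, derivative_natCast,
        Nat.cast_add, Nat.cast_one, map_one]
      linear_combination (C (b (K + 1)) * quad ^ K * (K + 2) * (K + 1)) * derivative_quad_sq
    rw [this]
    simp only [map_mul, map_add, map_natCast, map_ofNat, map_one, Nat.cast_add, Nat.cast_one]
    ring

/-! ### Legendre's differential equation and its symmetric square -/

/-- The polynomial `∫₀ˣ D_n`, where `D_n` is the `n`-th Delannoy polynomial
`∑ C(n,k) C(n+k,k) x^k`; its value at `1` is the Schröder number `S_n`. -/
noncomputable def schroderPoly (n : ℕ) : ℚ[X] :=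
  ∑ k ∈ Finset.range (n + 1), monomial (k + 1) ((n.choose k : ℚ) * (n + k).choose k / (k + 1))

theorem coeff_schroderPoly_zero (n : ℕ) : (schroderPoly n).coeff 0 = 0 := by
  simp [schroderPoly, coeff_monomial]

theorem coeff_schroderPoly_succ (n m : ℕ) :
    (schroderPoly n).coeff (m + 1) = (n.choose m : ℚ) * (n + m).choose m / (m + 1) := by
  rw [schroderPoly, finsetSum_coeff]
  simp only [coeff_monomial, add_left_inj]
  rw [Finset.sum_ite_eq']
  split_ifs with h
  · rfl
  · rw [Nat.choose_eq_zero_of_lt (by simpa using h)]; simp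

theorem eval_one_schroderPoly (n : ℕ) : (schroderPoly n).eval 1 = schroderNumber n := by
  simp only [schroderPoly, schroderNumber, eval_finsetSum, eval_monomial, one_pow, mul_one,
    mul_one_div]

theorem eval_one_derivative_schroderPoly (n : ℕ) :
    (derivative (schroderPoly n)).eval 1 = delannoyNumber n := by
  simp only [schroderPoly, delannoyNumber, derivative_sum, derivative_monomial, eval_finsetSum,
    eval_monomial, one_pow, mul_one, Nat.cast_sum, Nat.cast_mul, Nat.cast_add, Nat.cast_one]
  refine Finset.sum_congr rfl fun k _ => ?_
  field_simp

theorem choose_mul_choose_add_succ (n m : ℕ) :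
    (n.choose (m + 1) : ℚ) * (n + (m + 1)).choose (m + 1) * (m + 1) ^ 2 =
      n.choose m * (n + m).choose m * ((n - m) * (n + m + 1)) := by
  have h1 : (n.choose (m + 1) : ℚ) * (m + 1) = n.choose m * (n - m) := by
    rcases le_or_gt m n with h | h
    · rw [← Nat.cast_sub h]
      exact_mod_cast Nat.choose_succ_right_eq n m
    · rw [Nat.choose_eq_zero_of_lt h, Nat.choose_eq_zero_of_lt (by omega)]; simp
  have h2 : ((n + (m + 1)).choose (m + 1) : ℚ) * (m + 1) = (n + m + 1) * (n + m).choose m := by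
    exact_mod_cast (Nat.add_one_mul_choose_eq (n + m) m).symm
  linear_combination ((n + (m + 1)).choose (m + 1) : ℚ) * (m + 1) * h1 +
    (n.choose m * (n - m) : ℚ) * h2

/-- Legendre's differential equation, integrated once. -/
theorem quad_mul_derivative_derivative_schroderPoly (n : ℕ) :
    quad * derivative (derivative (schroderPoly n)) = C (n * (n + 1) : ℚ) * schroderPoly n := by
  ext m
  rw [quad, add_mul, coeff_add, coeff_C_mul, coeff_X_pow_mul']
  rcases m with _ | m
  · simp [coeff_schroderPoly_zero]
  rw [coeff_X_mul, coeff_derivative, coeff_derivative, coeff_schroderPoly_succ,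
    coeff_schroderPoly_succ]
  have h := choose_mul_choose_add_succ n m
  rcases m with _ | m
  · simp
  · rw [if_pos (by omega), show m + 1 + 1 - 2 = m by omega, coeff_derivative, coeff_derivative,
      coeff_schroderPoly_succ]
    push_cast at h ⊢
    field_simp
    linear_combination h

/-- A polynomial solution of the differential equation satisfied by products of two solutions of
`w F'' = a F`, `w = x + x²`, is determined by its coefficients up to degree two. -/
theorem eq_zero_of_ode (a : ℚ) (Z : ℚ[X])
    (h : quad ^ 2 * derivative (derivative (derivative Z)) =
      C a * (4 * quad * derivative Z - 2 * (1 + 2 * X) * Z))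
    (h0 : Z.coeff 0 = 0) (h1 : Z.coeff 1 = 0) (h2 : Z.coeff 2 = 0) : Z = 0 := by
  ext r
  rw [coeff_zero]
  induction r using Nat.strong_induction_on with
  | _ r ih =>
    match r with
    | 0 => exact h0
    | 1 => exact h1
    | 2 => exact h2
    | s + 3 =>
      have hc := congrArg (fun P => P.coeff (s + 2)) h
      have hL : quad ^ 2 * derivative (derivative (derivative Z)) =
          X ^ 2 * derivative (derivative (derivative Z)) +
          C 2 * (X ^ 3 * derivative (derivative (derivative Z))) +
          X ^ 4 * derivative (derivative (derivative Z)) := by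
        simp only [quad, map_ofNat]; ring
      have hR : C a * (4 * quad * derivative Z - 2 * (1 + 2 * X) * Z) =
          C (4 * a) * (X ^ 1 * derivative Z) + C (4 * a) * (X ^ 2 * derivative Z) -
          C (2 * a) * Z - C (4 * a) * (X ^ 1 * Z) := by
        simp only [quad, map_ofNat, map_mul]; ring
      simp only [hL, hR, coeff_add, coeff_sub, coeff_C_mul, coeff_X_pow_mul', coeff_derivative]
        at hc
      rw [if_pos (show 2 ≤ s + 2 by omega), if_pos (show 2 ≤ s + 2 by omega),
        if_pos (show 1 ≤ s + 2 by omega), if_pos (show 1 ≤ s + 2 by omega)] at hc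
      rw [show s + 2 - 2 = s by omega, show s + 2 - 1 + 1 = s + 2 by omega,
        show s + 2 - 1 = s + 1 by omega, ih (s + 2) (by omega), ih (s + 1) (by omega)] at hc
      -- all other contributions in degree `s + 2` involve coefficients of degree below `s + 3`
      have e3 : (if 3 ≤ s + 2 then Z.coeff (s + 2 - 3 + 1 + 1 + 1) *
          (((s + 2 - 3 + 1 + 1 : ℕ) : ℚ) + 1) * (((s + 2 - 3 + 1 : ℕ) : ℚ) + 1) *
          (((s + 2 - 3 : ℕ) : ℚ) + 1) else 0) = 0 := by
        split_ifs with hs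
        · rw [ih _ (by omega)]; ring
        · rfl
      have e4 : (if 4 ≤ s + 2 then Z.coeff (s + 2 - 4 + 1 + 1 + 1) *
          (((s + 2 - 4 + 1 + 1 : ℕ) : ℚ) + 1) * (((s + 2 - 4 + 1 : ℕ) : ℚ) + 1) *
          (((s + 2 - 4 : ℕ) : ℚ) + 1) else 0) = 0 := by
        split_ifs with hs
        · rw [ih _ (by omega)]; ring
        · rfl
      rw [e3, e4] at hc
      have hpos : (((s + 1 + 1 : ℕ) : ℚ) + 1) * (((s + 1 : ℕ) : ℚ) + 1) * ((s : ℚ) + 1) ≠ 0 := by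
        positivity
      have : Z.coeff (s + 3) *
          ((((s + 1 + 1 : ℕ) : ℚ) + 1) * (((s + 1 : ℕ) : ℚ) + 1) * ((s : ℚ) + 1)) = 0 := by
        have e : Z.coeff (s + 1 + 1 + 1) = Z.coeff (s + 3) := rfl
        rw [e] at hc
        linear_combination hc
      exact (mul_eq_zero.mp this).resolve_right hpos

/-- The coefficients of `(∫₀ˣ D_n)²` as a polynomial in `x + x²`: the square is
`∑ schroderSqCoeff n k * (x + x²)^(k+1)` for `n ≥ 1`. -/
def schroderSqCoeff (n k : ℕ) : ℚ :=
  (n + k).choose (2 * k) * (k.centralBinom : ℚ) ^ 2 * k / ((k + 1) * (n * (n + 1)))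

theorem choose_succ_succ_two_mul (n k : ℕ) :
    ((n + (k + 1)).choose (2 * (k + 1)) : ℚ) * ((2 * k + 2) * (2 * k + 1)) =
      (n + k).choose (2 * k) * (n * (n + 1) - k * (k + 1)) := by
  have := choose_add_two_mul (n + k) (2 * k)
  push_cast at this
  rw [show n + (k + 1) = n + k + 1 by ring, show 2 * (k + 1) = 2 * k + 2 by ring]
  linear_combination this

theorem schroderSqCoeff_succ (n k : ℕ) :
    schroderSqCoeff n (k + 1) * ((k + 2) * (k + 1) * k) =
      2 * (2 * k + 1) * (n * (n + 1) - (k + 1) * k) * schroderSqCoeff n k := by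
  have h1 := choose_succ_succ_two_mul n k
  have h2 := centralBinom_succ_cast k
  have e1 : ((n + (k + 1)).choose (2 * (k + 1)) : ℚ) =
      (n + k).choose (2 * k) * (n * (n + 1) - k * (k + 1)) / ((2 * k + 2) * (2 * k + 1)) := by
    rw [eq_div_iff (by positivity)]; exact h1
  have e2 : ((k + 1).centralBinom : ℚ) = 2 * (2 * k + 1) * k.centralBinom / (k + 1) := by
    rw [eq_div_iff (by positivity)]; exact h2
  unfold schroderSqCoeff
  rw [e1, e2]
  push_cast
  rcases Nat.eq_zero_or_pos n with rfl | hn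
  · simp
  field_simp
  ring

/-- The differential operator of `eq_zero_of_ode` maps a power of `x + x²` to a combination of two
consecutive powers, up to the common factor `1 + 2x`. -/
theorem ode_quad_pow (a : ℚ) (k : ℕ) :
    quad ^ 2 * derivative (derivative (derivative (quad ^ (k + 1)))) -
      C a * (4 * quad * derivative (quad ^ (k + 1)) - 2 * (1 + 2 * X) * quad ^ (k + 1)) =
    C ((k + 1) * k * (k - 1) : ℚ) * (quad ^ k * (1 + 2 * X)) +
      C (2 * (2 * k + 1) * ((k + 1) * k - a)) * (quad ^ (k + 1) * (1 + 2 * X)) := by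
  rcases k with _ | _ | k
  · simp [derivative_quad, map_ofNat C 2]
    ring
  · simp only [zero_add, derivative_pow, derivative_quad, derivative_mul, Nat.cast_add,
      Nat.cast_one, map_add, map_one, map_mul, map_sub, map_ofNat, derivative_one, derivative_X,
      derivative_ofNat]
    simp
    ring
  · simp only [derivative_mul, derivative_pow, derivative_quad, map_mul, map_add,
        map_natCast, map_ofNat, zero_mul, zero_add, derivative_one,
        derivative_X, Nat.add_sub_cancel, mul_one, derivative_ofNat, derivative_natCast,
        Nat.cast_add, Nat.cast_one, map_one, map_sub]
    linear_combination ((k + 1) * (k + 2) * (k + 3) * quad ^ (k + 2) * (1 + 2 * X)) *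
      derivative_quad_sq

theorem coeff_sum_quad_pow (K : ℕ) (b : ℕ → ℚ) (m : ℕ) :
    (∑ k ∈ Finset.range K, C (b k) * quad ^ k).coeff m =
      ∑ k ∈ Finset.range K, b k * (if k ≤ m then (k.choose (m - k) : ℚ) else 0) := by
  simp only [finsetSum_coeff, coeff_C_mul, coeff_quad_pow]

theorem schroderPoly_sq {n : ℕ} (hn : 0 < n) :
    schroderPoly n ^ 2 =
      ∑ k ∈ Finset.range (n + 1), C (schroderSqCoeff n k) * quad ^ (k + 1) := by
  set F := schroderPoly n with hF
  set a : ℚ := n * (n + 1) with ha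
  set Y := ∑ k ∈ Finset.range (n + 1), C (schroderSqCoeff n k) * quad ^ (k + 1) with hY
  have hode : quad * derivative (derivative F) = C a * F :=
    quad_mul_derivative_derivative_schroderPoly n
  have hode' : (1 + 2 * X) * derivative (derivative F) +
      quad * derivative (derivative (derivative F)) = C a * derivative F := by
    have := congrArg derivative hode
    simpa [derivative_mul, derivative_quad] using this
  have hF2 : quad ^ 2 * derivative (derivative (derivative (F ^ 2))) =
      C a * (4 * quad * derivative (F ^ 2) - 2 * (1 + 2 * X) * F ^ 2) := by
    have e : derivative (derivative (derivative (F ^ 2))) =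
        6 * derivative F * derivative (derivative F) +
        2 * F * derivative (derivative (derivative F)) := by
      simp only [pow_two, derivative_mul, derivative_add]; ring
    have e1 : derivative (F ^ 2) = 2 * F * derivative F := by
      simp only [pow_two, derivative_mul]; ring
    rw [e, e1]
    linear_combination (6 * quad * derivative F - 2 * F * (1 + 2 * X)) * hode +
      (2 * quad * F) * hode'
  have hYode : quad ^ 2 * derivative (derivative (derivative Y)) =
      C a * (4 * quad * derivative Y - 2 * (1 + 2 * X) * Y) := by
    rw [← sub_eq_zero]
    -- the contributions of consecutive powers of `x + x²` telescope
    set G : ℕ → ℚ[X] := fun k =>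
      C (schroderSqCoeff n k * ((k + 1) * k * (k - 1))) * (quad ^ k * (1 + 2 * X)) with hG
    have : quad ^ 2 * derivative (derivative (derivative Y)) -
        C a * (4 * quad * derivative Y - 2 * (1 + 2 * X) * Y) =
        ∑ k ∈ Finset.range (n + 1), (G k - G (k + 1)) := by
      simp only [hY, derivative_sum, derivative_C_mul, Finset.mul_sum, ← Finset.sum_sub_distrib]
      refine Finset.sum_congr rfl fun k _ => ?_
      have h1 := ode_quad_pow a k
      have h2 := congrArg C (schroderSqCoeff_succ n k)
      rw [hG]
      simp only [map_mul, map_add, map_sub, map_ofNat, map_natCast, map_one, Nat.cast_add,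
        Nat.cast_one, ha] at h1 h2 ⊢
      linear_combination C (schroderSqCoeff n k) * h1 + quad ^ (k + 1) * (1 + 2 * X) * h2
    rw [this, Finset.sum_range_sub']
    have h0 : G 0 = 0 := by simp [hG]
    have hn1 : G (n + 1) = 0 := by
      have : schroderSqCoeff n (n + 1) = 0 := by
        unfold schroderSqCoeff
        rw [Nat.choose_eq_zero_of_lt (by omega)]; simp
      simp [hG, this]
    rw [h0, hn1, sub_zero]
  rw [← sub_eq_zero]
  have hcF0 : F.coeff 0 = 0 := coeff_schroderPoly_zero n
  have hcF1 : F.coeff 1 = 1 := by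
    have := coeff_schroderPoly_succ n 0
    simpa using this
  have hcY : ∀ m, m ≤ 2 → Y.coeff m = if m = 2 then 1 else 0 := by
    intro m hm
    obtain ⟨N, rfl⟩ : ∃ N, n = N + 1 := ⟨n - 1, by omega⟩
    rw [hY, finsetSum_coeff, Finset.sum_range_succ', Finset.sum_range_succ']
    simp only [coeff_C_mul, coeff_quad_pow]
    rw [Finset.sum_eq_zero]
    · have y0 : schroderSqCoeff (N + 1) 0 = 0 := by simp [schroderSqCoeff]
      have y1 : schroderSqCoeff (N + 1) 1 = 1 := by
        have := choose_succ_succ_two_mul (N + 1) 0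
        simp at this
        unfold schroderSqCoeff
        simp [Nat.centralBinom]
        field_simp
        linear_combination 2 * this
      rw [zero_add, zero_add, y0, y1]
      interval_cases m <;> simp
    · intro k _
      rw [if_neg (by omega), mul_zero]
  apply eq_zero_of_ode a
  · simp only [derivative_sub]
    linear_combination hF2 - hYode
  · rw [coeff_sub, hcY 0 (by norm_num), pow_two, mul_coeff_zero, hcF0]; simp
  · rw [coeff_sub, hcY 1 (by norm_num), pow_two, mul_coeff_one, hcF0]; simp
  · rw [coeff_sub, hcY 2 (by norm_num), pow_two, coeff_mul,
      Finset.Nat.sum_antidiagonal_eq_sum_range_succ (fun i j => F.coeff i * F.coeff j)]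
    simp [Finset.sum_range_succ, hcF0, hcF1]

theorem derivative_schroderPoly_mul_derivative (n : ℕ) :
    derivative (schroderPoly n * derivative (schroderPoly n)) =
      ∑ k ∈ Finset.range (n + 1),
        C ((n + k).choose (2 * k) * (k.centralBinom : ℚ) ^ 2 * (2 * k + 1) / (k + 1)) *
          quad ^ k := by
  rcases Nat.eq_zero_or_pos n with rfl | hn
  -- for `n = 0` the square `x²` is not a polynomial in `x + x²`, but the claim still holds
  · simp [schroderPoly, monomial_one_one_eq_X]
  have hsq := congrArg derivative (congrArg derivative (schroderPoly_sq hn))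
  rw [derivative_derivative_sum_quad] at hsq
  have e : derivative (derivative (schroderPoly n ^ 2)) =
      C 2 * derivative (schroderPoly n * derivative (schroderPoly n)) := by
    simp only [pow_two, derivative_mul, derivative_add, map_ofNat]; ring
  have key : ∀ k : ℕ, 2 * (k + 1) * (2 * k + 1) * schroderSqCoeff n k +
      (k + 2) * (k + 1) * schroderSqCoeff n (k + 1) =
      2 * ((n + k).choose (2 * k) * (k.centralBinom : ℚ) ^ 2 * (2 * k + 1) / (k + 1)) := by
    intro k
    have h1 := choose_succ_succ_two_mul n k
    have h2 := centralBinom_succ_cast k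
    have e1 : ((n + (k + 1)).choose (2 * (k + 1)) : ℚ) =
        (n + k).choose (2 * k) * (n * (n + 1) - k * (k + 1)) / ((2 * k + 2) * (2 * k + 1)) := by
      rw [eq_div_iff (by positivity)]; exact h1
    have e2 : ((k + 1).centralBinom : ℚ) = 2 * (2 * k + 1) * k.centralBinom / (k + 1) := by
      rw [eq_div_iff (by positivity)]; exact h2
    unfold schroderSqCoeff
    rw [e1, e2]
    push_cast
    field_simp
    ring
  have hlast : schroderSqCoeff n (n + 1) = 0 := by
    unfold schroderSqCoeff
    rw [Nat.choose_eq_zero_of_lt (by omega)]; simp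
  have h2 : (C 2 : ℚ[X]) ≠ 0 := by simp
  apply mul_left_cancel₀ h2
  rw [← e, hsq, Finset.mul_sum, Finset.sum_range_succ]
  congr 1
  · refine Finset.sum_congr rfl fun k _ => ?_
    rw [key, map_mul, mul_assoc]
  · rw [← mul_assoc, ← map_mul, ← key n, hlast, mul_zero, add_zero]

/-! ### The sum of products as an integral -/

/-- The product `D_n S_n` as an integralover `[0, 1]` of a polynomial in `x + x²`. -/
theorem delannoy_mul_schroder (n : ℕ) :
    (delannoyNumber n : ℚ) * schroderNumber n =
      ∑ k ∈ Finset.range (n + 1),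
        (n + k).choose (2 * k) * (k.centralBinom : ℚ) ^ 2 * (2 * k + 1) / (k + 1) *
          integ (quad ^ k) := by
  have h := congrArg integ (derivative_schroderPoly_mul_derivative n)
  rw [integ_derivative, eval_mul, eval_mul, eval_one_schroderPoly,
    eval_one_derivative_schroderPoly, ← coeff_zero_eq_eval_zero, coeff_schroderPoly_zero,
    map_sum] at h
  simp only [C_mul', map_smul, smul_eq_mul] at h
  rw [← h]; ring

theorem sum_choose_add_two_mul (k N : ℕ) :
    ∑ n ∈ Finset.range N, (n + k).choose (2 * k) = (N + k).choose (2 * k + 1) := by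
  induction N with
  | zero => simp; rw [Nat.choose_eq_zero_of_lt (by omega)]
  | succ N ih =>
    rw [Finset.sum_range_succ, ih, show N + 1 + k = N + k + 1 by ring, Nat.choose_succ_succ,
      add_comm]

/-- The product `∏_{i=1}^k (1 - N²/i²) = (-1)^k C(N-1,k) C(N+k,k)`. -/
def sqProd (N k : ℕ) : ℚ := ∏ i ∈ Finset.range k, (1 - (N : ℚ) ^ 2 / (i + 1) ^ 2)

theorem choose_mul_centralBinom_eq_sqProd (N k : ℕ) :
    ((N + k).choose (2 * k + 1) : ℚ) * k.centralBinom * (2 * k + 1) =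
      N * ((-1) ^ k * sqProd N k) := by
  induction k with
  | zero => simp [sqProd]
  | succ k ih =>
    have h1 := choose_add_two_mul (N + k) (2 * k + 1)
    have h2 := centralBinom_succ_cast k
    rw [sqProd, Finset.prod_range_succ, ← sqProd]
    push_cast at h1 ⊢
    rw [show N + (k + 1) = N + k + 1 by ring, show 2 * (k + 1) + 1 = 2 * k + 1 + 2 by ring]
    have e2 : ((k + 1).centralBinom : ℚ) = 2 * (2 * k + 1) * k.centralBinom / (k + 1) := by
      rw [eq_div_iff (by positivity)]; exact h2
    have e1 : ((N + k + 1).choose (2 * k + 1 + 2) : ℚ) =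
        (N + k).choose (2 * k + 1) * ((N + k + 1) * (N + k - (2 * k + 1))) /
          ((2 * k + 1 + 2) * (2 * k + 1 + 1)) := by
      rw [eq_div_iff (by positivity)]; exact h1
    rw [e1, e2]
    field_simp
    linear_combination (2 * (k + 1) * (2 * k + 3) * (N ^ 2 - (k + 1) ^ 2) : ℚ) * ih

/-- The Catalan number `C(2k,k)/(k+1)` as a rational number. -/
def ratCatalan (k : ℕ) : ℚ := k.centralBinom / (k + 1)

/-- The sum over `n` is a hockey-stick sum of binomial coefficients, which turns `C(n+k,2k)` into
`C(N+k,2k+1)`. -/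
theorem sum_delannoy_mul_schroder (N : ℕ) :
    ∑ n ∈ Finset.range N, (delannoyNumber n : ℚ) * schroderNumber n =
      N * ∑ k ∈ Finset.range N, (-1) ^ k * sqProd N k * ratCatalan k * integ (quad ^ k) := by
  have h1 : ∀ n ∈ Finset.range N, (delannoyNumber n : ℚ) * schroderNumber n =
      ∑ k ∈ Finset.range N,
        (n + k).choose (2 * k) * ((k.centralBinom : ℚ) ^ 2 * (2 * k + 1) / (k + 1) *
          integ (quad ^ k)) := by
    intro n hn
    rw [delannoy_mul_schroder]
    rw [← Finset.sum_subset (Finset.range_mono (Finset.mem_range.mp hn) :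
      Finset.range (n + 1) ⊆ Finset.range N)]
    · exact Finset.sum_congr rfl fun k _ => by ring
    · intro k _ hk
      rw [Nat.choose_eq_zero_of_lt (by simp at hk; omega)]; simp
  rw [Finset.sum_congr rfl h1, Finset.sum_comm, Finset.mul_sum]
  refine Finset.sum_congr rfl fun k _ => ?_
  rw [← Finset.sum_mul, ← Nat.cast_sum, sum_choose_add_two_mul, ratCatalan]
  linear_combination (k.centralBinom / (k + 1) * integ (quad ^ k) : ℚ) *
    choose_mul_centralBinom_eq_sqProd N k

/-! ### Truncated Catalan generating functions -/

theorem coeff_quad_mul_one (P : ℚ[X]) : (quad * P).coeff 1 = P.coeff 0 := by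
  rw [quad, add_mul, coeff_add, coeff_X_pow_mul', show (1 : ℕ) = 0 + 1 from rfl, coeff_X_mul]
  simp

theorem coeff_quad_mul_add_two (P : ℚ[X]) (m : ℕ) :
    (quad * P).coeff (m + 2) = P.coeff (m + 1) + P.coeff m := by
  rw [quad, add_mul, coeff_add, coeff_X_pow_mul, show m + 2 = m + 1 + 1 from rfl, coeff_X_mul]

/-- The polynomial `∑_{k<K} (-1)^k h_k Cat_k (x + x²)^k`, a truncation of the Catalan generating
function (equal to `1 / (1 + x)` when `h = 1`) with weights `h`. -/
noncomputable def catalanPoly (h : ℕ → ℚ) (K : ℕ) : ℚ[X] :=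
  ∑ k ∈ Finset.range K, C ((-1 : ℚ) ^ k * h k * ratCatalan k) * quad ^ k

theorem coeff_catalanPoly (h : ℕ → ℚ) (K m : ℕ) :
    (catalanPoly h K).coeff m = ∑ k ∈ Finset.range K,
      (-1) ^ k * h k * ratCatalan k * (if k ≤ m then (k.choose (m - k) : ℚ) else 0) :=
  coeff_sum_quad_pow _ _ _

theorem natDegree_catalanPoly_lt (h : ℕ → ℚ) {K : ℕ} (hK : 0 < K) :
    (catalanPoly h K).natDegree < 2 * K - 1 := by
  have : (catalanPoly h K).natDegree ≤ 2 * (K - 1) := by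
    refine natDegree_sum_le_of_forall_le _ _ fun k hk => ?_
    have := Finset.mem_range.mp hk
    calc _ ≤ (quad ^ k).natDegree := natDegree_C_mul_le _ _
      _ ≤ 2 * k := natDegree_quad_pow_le k
      _ ≤ 2 * (K - 1) := by omega
  omega

theorem coeff_catalanPoly_zero (h : ℕ → ℚ) (K : ℕ) : (catalanPoly h (K + 1)).coeff 0 = h 0 := by
  rw [coeff_catalanPoly, Finset.sum_range_succ', Finset.sum_eq_zero]
  · simp [ratCatalan]
  · intro k _; simp

/-- Differentiating twice turns the weights of `catalanPoly` into their differences. -/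
theorem derivative_derivative_quad_mul_catalanPoly (h : ℕ → ℚ) (K : ℕ) :
    derivative (derivative (quad * catalanPoly h (K + 1))) =
      ∑ k ∈ Finset.range K,
        C ((-1 : ℚ) ^ k * (k + 1).centralBinom * (k + 1) * (h k - h (k + 1))) * quad ^ k +
      C ((-1 : ℚ) ^ K * (K + 1) * (K + 1).centralBinom * h K) * quad ^ K := by
  have e : quad * catalanPoly h (K + 1) =
      ∑ k ∈ Finset.range (K + 1), C ((-1 : ℚ) ^ k * h k * ratCatalan k) * quad ^ (k + 1) := by
    rw [catalanPoly, Finset.mul_sum]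
    exact Finset.sum_congr rfl fun k _ => by ring
  have hc : ∀ k : ℕ, 2 * (k + 1) * (2 * k + 1) * ratCatalan k =
      (k + 1) * (k + 1).centralBinom := by
    intro k
    have h2 := centralBinom_succ_cast k
    unfold ratCatalan
    field_simp
    linear_combination -h2
  rw [e, derivative_derivative_sum_quad]
  congr 1
  · refine Finset.sum_congr rfl fun k _ => ?_
    congr 2
    have h1 : (k + 2) * ratCatalan (k + 1) = (k + 1).centralBinom := by
      unfold ratCatalan; push_cast; field_simp; ring
    linear_combination ((-1) ^ k * h k) * hc k + (k + 1) * (-1) ^ (k + 1) * h (k + 1) * h1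
  · congr 2
    linear_combination ((-1) ^ K * h K) * hc K

/-- With all weights equal to `1` the differences vanish, so that only the top power of `x + x²`
survives two differentiations; this determines all coefficients of the truncated Catalan series. -/
theorem coeff_catalanPoly_one_recurrence (K m : ℕ) :
    (m + 2) * (m + 1) * ((catalanPoly 1 (K + 1)).coeff (m + 1) +
      (catalanPoly 1 (K + 1)).coeff m) =
      (-1) ^ K * (K + 1) * (K + 1).centralBinom *
        (if K ≤ m then (K.choose (m - K) : ℚ) else 0) := by
  have h := congrArg (fun P => P.coeff m) (derivative_derivative_quad_mul_catalanPoly 1 K)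
  simp only [Pi.one_apply, sub_self, mul_zero, map_zero, zero_mul, Finset.sum_const_zero,
    zero_add, mul_one, coeff_C_mul, coeff_quad_pow, coeff_derivative,
    coeff_quad_mul_add_two] at h
  rw [← h]
  push_cast
  ring

theorem coeff_catalanPoly_one_of_lt {K m : ℕ} (hm : m < K) :
    (catalanPoly 1 K).coeff m = (-1) ^ m := by
  obtain ⟨K, rfl⟩ : ∃ L, K = L + 1 := ⟨K - 1, by omega⟩
  induction m with
  | zero => rw [coeff_catalanPoly_zero]; simp
  | succ m ih =>
    have h := coeff_catalanPoly_one_recurrence K m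
    rw [if_neg (by omega), mul_zero, ih (by omega)] at h
    have h' := (mul_eq_zero.mp h).resolve_left (by positivity)
    linear_combination h'

/-- The generalized harmonic number `∑_{i=1}^n 1 / i^s`. -/
def genHarmonic (s n : ℕ) : ℚ := ∑ i ∈ Finset.range n, 1 / ((i : ℚ) + 1) ^ s

theorem genHarmonic_zero (s : ℕ) : genHarmonic s 0 = 0 := by simp [genHarmonic]

theorem genHarmonic_succ (s n : ℕ) :
    genHarmonic s (n + 1) = genHarmonic s n + 1 / ((n : ℚ) + 1) ^ s := by
  simp [genHarmonic, Finset.sum_range_succ]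

/-- The series `∑ (-1)^k C(2k,k) (x + x²)^k` is `(1 + 4 (x + x²))^(-1/2) = 1 / (1 + 2x)`; a partial
sum multiplied by `1 + 2x` is not `1`, but its derivative is a single power of `x + x²`. -/
theorem derivative_mul_sum_centralBinom (K : ℕ) :
    derivative ((1 + 2 * X) *
      ∑ k ∈ Finset.range (K + 1), C ((-1 : ℚ) ^ k * k.centralBinom : ℚ) * quad ^ k) =
      C ((-1 : ℚ) ^ K * (4 * K + 2) * K.centralBinom) * quad ^ K := by
  induction K with
  | zero => simp [map_ofNat C 2]
  | succ K ih =>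
    rw [Finset.sum_range_succ, mul_add, derivative_add, ih]
    have h2 := congrArg C (centralBinom_succ_cast K)
    simp only [derivative_mul, derivative_pow, derivative_quad, map_mul, map_add, map_natCast,
      map_ofNat, derivative_one, derivative_X, Nat.add_sub_cancel, mul_one,
      derivative_ofNat, Nat.cast_add, Nat.cast_one, map_one, map_pow, map_neg]
      at h2 ⊢
    simp only [derivative_natCast]
    linear_combination ((-1) ^ (K + 1) * ((K + 1).centralBinom : ℚ[X]) * (K + 1) * quad ^ K) *
      derivative_quad_sq + (-1) ^ (K + 1) * quad ^ K * h2

/-- The polynomial `-∑_{k<K} (-1)^k C(2k+2,k+1)/(k+1) (x + x²)^k`, a truncation of the series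
`-2 log (1 + x) / (x + x²)`. -/
noncomputable def logPoly (K : ℕ) : ℚ[X] :=
  ∑ k ∈ Finset.range K, C ((-1 : ℚ) ^ (k + 1) * (k + 1).centralBinom / (k + 1)) * quad ^ k

theorem quad_mul_derivative_logPoly (K : ℕ) :
    quad * derivative (quad * logPoly K) = (1 + 2 * X) *
      ∑ k ∈ Finset.range (K + 1), C ((-1 : ℚ) ^ k * k.centralBinom : ℚ) * quad ^ k -
      (1 + 2 * X) := by
  rw [Finset.sum_range_succ', mul_add]
  simp only [pow_zero, Nat.centralBinom_zero, Nat.cast_one, mul_one, map_one, add_sub_cancel_right]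
  rw [logPoly, Finset.mul_sum, derivative_sum, Finset.mul_sum, Finset.mul_sum]
  refine Finset.sum_congr rfl fun k _ => ?_
  have e : quad * (C ((-1 : ℚ) ^ (k + 1) * ((k + 1).centralBinom : ℚ) / (k + 1)) * quad ^ k) =
      C ((-1 : ℚ) ^ (k + 1) * ((k + 1).centralBinom : ℚ) / (k + 1)) * quad ^ (k + 1) := by ring
  rw [e, derivative_C_mul, derivative_pow, derivative_quad]
  have e2 : C ((-1 : ℚ) ^ (k + 1) * ((k + 1).centralBinom : ℚ) / (k + 1)) * C (((k + 1 : ℕ) : ℚ)) =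
      C ((-1 : ℚ) ^ (k + 1) * ((k + 1).centralBinom : ℚ)) := by
    rw [← map_mul]
    congr 1
    push_cast
    field_simp
  simp only [Nat.add_sub_cancel]
  linear_combination (quad ^ (k + 1) * (1 + 2 * X)) * e2

/-- `derivative (quad * logPoly K)` agrees with `-2 / (1 + x)` below degree `K`. -/
theorem coeff_derivative_quad_mul_logPoly {K m : ℕ} (hm : m < K) :
    (derivative (quad * logPoly K)).coeff m = -2 * (-1) ^ m := by
  set T := (1 + 2 * X) *
    ∑ k ∈ Finset.range (K + 1), C ((-1 : ℚ) ^ k * k.centralBinom : ℚ) * quad ^ k with hT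
  have hT0 : ∀ j, j < K → T.coeff (j + 1) = 0 := by
    intro j hj
    have h := congrArg (fun P => P.coeff j) (derivative_mul_sum_centralBinom K)
    simp only [← hT, coeff_derivative, coeff_C_mul, coeff_quad_pow] at h
    rw [if_neg (by omega), mul_zero] at h
    exact (mul_eq_zero.mp h).resolve_right (by positivity)
  have hX : ∀ j, (1 + 2 * X : ℚ[X]).coeff (j + 1) = if j = 0 then 2 else 0 := by
    intro j
    rw [coeff_add, show (2 : ℚ[X]) = C 2 from (map_ofNat C 2).symm, coeff_C_mul, coeff_X,
      coeff_one]
    rcases j with _ | j <;> simp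
  have h := quad_mul_derivative_logPoly K
  rw [← hT] at h
  induction m with
  | zero =>
    have h1 := congrArg (fun P => P.coeff 1) h
    simp only [coeff_quad_mul_one, coeff_sub] at h1
    rw [hT0 0 hm, hX 0] at h1
    rw [h1]; simp
  | succ m ih =>
    have h1 := congrArg (fun P => P.coeff (m + 2)) h
    simp only [coeff_quad_mul_add_two, coeff_sub] at h1
    rw [hT0 (m + 1) hm, hX (m + 1), if_neg (by omega), ih (by omega)] at h1
    linear_combination h1

theorem coeff_logPoly {K m : ℕ} (hm : m < K) :
    (logPoly K).coeff m = -2 * (-1) ^ m * genHarmonic 1 (m + 1) := by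
  induction m with
  | zero =>
    have h := coeff_derivative_quad_mul_logPoly hm
    rw [coeff_derivative, zero_add, coeff_quad_mul_one] at h
    simpa [genHarmonic] using h
  | succ m ih =>
    have h := coeff_derivative_quad_mul_logPoly hm
    rw [coeff_derivative, coeff_quad_mul_add_two, ih (by omega)] at h
    rw [genHarmonic_succ]
    push_cast at h ⊢
    field_simp
    linear_combination h

/-- Up to degree `K`, the polynomial with weights `∑_{i≤k} 1/i²` has the same coefficients as the
corresponding power series, and these have a closed form. -/
theorem coeff_catalanPoly_genHarmonic_two {K m : ℕ} (hm : m ≤ K) :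
    (catalanPoly (genHarmonic 2) (K + 1)).coeff m =
      2 * (-1) ^ m * (genHarmonic 2 m - genHarmonic 1 m / (m + 1)) := by
  induction m with
  | zero => rw [coeff_catalanPoly_zero]; simp [genHarmonic_zero]
  | succ m ih =>
    have h := congrArg (fun P => P.coeff m)
      (derivative_derivative_quad_mul_catalanPoly (genHarmonic 2) K)
    have e : ∑ k ∈ Finset.range K, C ((-1 : ℚ) ^ k * ((k + 1).centralBinom : ℚ) * (k + 1) *
        (genHarmonic 2 k - genHarmonic 2 (k + 1))) * quad ^ k = logPoly K := by
      refine Finset.sum_congr rfl fun k _ => ?_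
      congr 2
      rw [genHarmonic_succ]
      field_simp
      ring
    simp only [e, coeff_add, coeff_C_mul, coeff_quad_pow, coeff_derivative,
      coeff_quad_mul_add_two] at h
    rw [if_neg (by omega), mul_zero, add_zero, coeff_logPoly (by omega), ih (by omega)] at h
    rw [genHarmonic_succ] at h ⊢
    rw [genHarmonic_succ]
    have hne : ((m : ℚ) + 2) * (m + 1) ≠ 0 := by positivity
    apply mul_left_cancel₀ hne
    push_cast at h ⊢
    have h1 : (m : ℚ) + 1 + 1 ≠ 0 := by positivity
    have h2 : (m : ℚ) + 2 ≠ 0 := by positivity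
    field_simp at h ⊢
    linear_combination h

end Polynomials

/-! ### Congruences between rational numbers -/

/-- The additive group `p^r ℤ_(p)` of rational numbers `p^r z` with `z` integral at `p`;
`x - y ∈ padicBall p r` is congruence modulo `p^r`. -/
def padicBall (p r : ℕ) : AddSubgroup ℚ where
  carrier := {x | ∃ z : ℚ, z.den.Coprime p ∧ x = (p : ℚ) ^ r * z}
  zero_mem' := ⟨0, by simp, by simp⟩
  add_mem' := by
    rintro _ _ ⟨z, hz, rfl⟩ ⟨w, hw, rfl⟩
    exact ⟨z + w, Nat.Coprime.of_dvd_left (Rat.add_den_dvd z w) (hz.mul_left hw), by ring⟩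
  neg_mem' := by
    rintro _ ⟨z, hz, rfl⟩
    exact ⟨-z, by simpa using hz, by ring⟩

namespace padicBall

variable {p r s : ℕ} {x y : ℚ}

theorem of_eq (h : x ∈ padicBall p r) (e : y = x) : y ∈ padicBall p r := e ▸ h

theorem mul_mem_add (hx : x ∈ padicBall p r) (hy : y ∈ padicBall p s) :
    x * y ∈ padicBall p (r + s) := by
  obtain ⟨z, hz, rfl⟩ := hx
  obtain ⟨w, hw, rfl⟩ := hy
  exact ⟨z * w, Nat.Coprime.of_dvd_left (Rat.mul_den_dvd z w) (hz.mul_left hw), by ring⟩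

theorem mul_mem_left (hx : x ∈ padicBall p 0) (hy : y ∈ padicBall p r) :
    x * y ∈ padicBall p r :=
  zero_add r ▸ mul_mem_add hx hy

theorem mul_mem_right (hx : x ∈ padicBall p r) (hy : y ∈ padicBall p 0) :
    x * y ∈ padicBall p r :=
  mul_mem_add hx hy

theorem intCast_mem (n : ℤ) : (n : ℚ) ∈ padicBall p 0 := ⟨n, by simp, by simp⟩

theorem natCast_mem (n : ℕ) : (n : ℚ) ∈ padicBall p 0 := by exact_mod_cast intCast_mem n

theorem ofNat_mem (n : ℕ) [n.AtLeastTwo] : (OfNat.ofNat n : ℚ) ∈ padicBall p 0 :=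
  natCast_mem n

theorem one_mem : (1 : ℚ) ∈ padicBall p 0 := by exact_mod_cast natCast_mem 1

theorem neg_one_pow_mem (k : ℕ) : (-1 : ℚ) ^ k ∈ padicBall p 0 := by
  exact_mod_cast intCast_mem ((-1) ^ k)

theorem neg_one_pow_mul_mem (k : ℕ) (hx : x ∈ padicBall p r) :
    (-1 : ℚ) ^ k * x ∈ padicBall p r :=
  mul_mem_left (neg_one_pow_mem k) hx

theorem pow_mem_ball : (p : ℚ) ^ r ∈ padicBall p r := ⟨1, by simp, by simp⟩

theorem self_mem_one : (p : ℚ) ∈ padicBall p 1 := ⟨1, by simp, by simp⟩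

theorem pow_mul_mem (s : ℕ) (hx : x ∈ padicBall p r) :
    (p : ℚ) ^ s * x ∈ padicBall p (s + r) :=
  mul_mem_add pow_mem_ball hx

theorem self_mul_mem (hx : x ∈ padicBall p r) : (p : ℚ) * x ∈ padicBall p (r + 1) :=
  add_comm 1 r ▸ mul_mem_add self_mem_one hx

theorem mono (h : s ≤ r) (hx : x ∈ padicBall p r) : x ∈ padicBall p s := by
  obtain ⟨t, rfl⟩ := Nat.exists_eq_add_of_le h
  obtain ⟨z, hz, rfl⟩ := hx
  have hz' : z ∈ padicBall p 0 := ⟨z, hz, by simp⟩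
  exact of_eq (mul_mem_right (pow_mem_ball (r := s)) (mul_mem_left (natCast_mem (p ^ t)) hz'))
    (by push_cast; ring)

theorem pow_mem_zero (hx : x ∈ padicBall p 0) (k : ℕ) : x ^ k ∈ padicBall p 0 := by
  induction k with
  | zero => simpa using one_mem
  | succ k ih => rw [pow_succ]; exact mul_mem_left ih hx

theorem inv_natCast_mem {n : ℕ} (h : n.Coprime p) : (n : ℚ)⁻¹ ∈ padicBall p 0 := by
  refine ⟨(n : ℚ)⁻¹, ?_, by simp⟩
  rw [Rat.inv_natCast_den]
  split_ifs
  · simp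
  · exact h

theorem of_natCast_mul_mem {n : ℕ} (h : n.Coprime p) (h0 : n ≠ 0)
    (hx : (n : ℚ) * x ∈ padicBall p r) : x ∈ padicBall p r :=
  of_eq (mul_mem_left (inv_natCast_mem h) hx) (by field_simp)

theorem natCast_mem_one {n : ℕ} (h : p ∣ n) : (n : ℚ) ∈ padicBall p 1 := by
  obtain ⟨m, rfl⟩ := h
  exact ⟨m, by simp, by push_cast; ring⟩

theorem intCast_mem_pow {n : ℤ} (h : (p : ℤ) ^ r ∣ n) : (n : ℚ) ∈ padicBall p r := by
  obtain ⟨m, rfl⟩ := h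
  exact ⟨m, by simp, by push_cast; ring⟩

theorem coprime_of_lt (hp : p.Prime) {k : ℕ} (h0 : 0 < k) (hk : k < p) : k.Coprime p :=
  Nat.Coprime.symm ((hp.coprime_iff_not_dvd).2 (Nat.not_dvd_of_pos_of_lt h0 hk))

theorem coprime_add (hp : p.Prime) {k : ℕ} (h0 : 0 < k) (hk : k < p) : (p + k).Coprime p := by
  simpa using coprime_of_lt hp h0 hk

end padicBall

theorem ratModEq_pow_iff {p r : ℕ} (hr : r ≠ 0) (x y : ℚ) :
    RatModEq (p ^ r) x y ↔ x - y ∈ padicBall p r := by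
  unfold RatModEq
  constructor
  · rintro ⟨z, hz, h⟩
    exact ⟨z, (Nat.coprime_pow_right_iff (Nat.pos_of_ne_zero hr) _ _).1 hz, by
      rw [h]; push_cast; ring⟩
  · rintro ⟨z, hz, h⟩
    exact ⟨z, Nat.Coprime.pow_right r hz, by rw [h]; push_cast; ring⟩

/-! ### Harmonic numbers modulo powers of a prime -/

section Harmonic

open padicBall

variable {p : ℕ}

theorem inv_succ_mem (hp : p.Prime) {i : ℕ} (hi : i < p - 1) :
    ((i : ℚ) + 1)⁻¹ ∈ padicBall p 0 := by
  have := inv_natCast_mem (p := p) (coprime_of_lt hp (Nat.succ_pos i) (by omega))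
  simpa using this

theorem inv_prime_add_succ_mem (hp : p.Prime) {i : ℕ} (hi : i < p - 1) :
    ((p : ℚ) + (i + 1))⁻¹ ∈ padicBall p 0 := by
  have := inv_natCast_mem (p := p) (coprime_add hp (Nat.succ_pos i) (by omega))
  simpa using this

theorem cast_prime_sub_succ {i : ℕ} (hi : i < p - 1) :
    ((p - (i + 1) : ℕ) : ℚ) = p - (i + 1) := by
  rw [Nat.cast_sub (by omega)]; push_cast; ring

theorem prime_sub_succ_ne_zero {i : ℕ} (hi : i < p - 1) : (p : ℚ) - (i + 1) ≠ 0 := by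
  have : ((i + 1 : ℕ) : ℚ) < p := by exact_mod_cast (by omega)
  push_cast at this
  linarith

theorem inv_prime_sub_succ_mem (hp : p.Prime) {i : ℕ} (hi : i < p - 1) :
    ((p : ℚ) - (i + 1))⁻¹ ∈ padicBall p 0 := by
  have := inv_natCast_mem (p := p)
    (coprime_of_lt hp (k := p - (i + 1)) (by omega) (by have := hp.pos; omega))
  rwa [cast_prime_sub_succ hi] at this

theorem sum_range_prime_reflect {M : Type*} [AddCommMonoid M] (g : ℕ → M) :
    ∑ i ∈ Finset.range (p - 1), g (p - (i + 1)) = ∑ i ∈ Finset.range (p - 1), g (i + 1) := by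
  rw [← Finset.sum_range_reflect]
  refine Finset.sum_congr rfl fun i hi => ?_
  have := Finset.mem_range.mp hi
  congr 1
  omega

theorem sum_mem_of_forall {r n : ℕ} {f : ℕ → ℚ} (h : ∀ i < n, f i ∈ padicBall p r) :
    ∑ i ∈ Finset.range n, f i ∈ padicBall p r :=
  sum_mem fun i hi => h i (Finset.mem_range.mp hi)

theorem genHarmonic_mem (hp : p.Prime) (s : ℕ) {n : ℕ} (hn : n ≤ p - 1) :
    genHarmonic s n ∈ padicBall p 0 := by
  refine sum_mem_of_forall fun i hi => ?_
  rw [one_div, ← inv_pow]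
  exact pow_mem_zero (inv_succ_mem hp (by omega)) s

theorem inv_prime_sub_add_mem (hp : p.Prime) {i : ℕ} (hi : i < p - 1) :
    ((p : ℚ) - (i + 1))⁻¹ + ((i : ℚ) + 1)⁻¹ ∈ padicBall p 1 :=
  of_eq (mul_mem_right self_mem_one
    (mul_mem_left (inv_succ_mem hp hi) (inv_prime_sub_succ_mem hp hi))) (by
      have := prime_sub_succ_ne_zero hi
      field_simp; ring)

theorem inv_prime_sub_sq_mem (hp : p.Prime) {i : ℕ} (hi : i < p - 1) :
    1 / ((p : ℚ) - (i + 1)) ^ 2 - 1 / ((i : ℚ) + 1) ^ 2 - p * (2 / ((i : ℚ) + 1) ^ 3) ∈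
      padicBall p 2 := by
  have h := mul_mem_right (pow_mem_ball (p := p) (r := 2))
    (mul_mem_left (pow_mem_zero (inv_prime_sub_succ_mem hp hi) 2)
      (mul_mem_left (pow_mem_zero (inv_succ_mem hp hi) 3)
        (sub_mem (mul_mem_left (ofNat_mem 3) (natCast_mem (i + 1)))
          (mul_mem_left (ofNat_mem 2) (natCast_mem p)))))
  refine of_eq h ?_
  have := prime_sub_succ_ne_zero hi
  push_cast
  field_simp
  ring

theorem inv_prime_sub_cube_mem (hp : p.Prime) {i : ℕ} (hi : i < p - 1) :
    1 / ((p : ℚ) - (i + 1)) ^ 3 + 1 / ((i : ℚ) + 1) ^ 3 ∈ padicBall p 1 := by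
  have h := inv_prime_sub_add_mem hp hi
  have a := inv_prime_sub_succ_mem hp hi
  have b := inv_succ_mem hp hi
  refine of_eq (mul_mem_right h (add_mem (sub_mem (pow_mem_zero a 2) (mul_mem_left a b))
    (pow_mem_zero b 2))) ?_
  rw [one_div, one_div, ← inv_pow, ← inv_pow]
  ring

theorem genHarmonic_three_mem (hp : p.Prime) (hp3 : 3 < p) :
    genHarmonic 3 (p - 1) ∈ padicBall p 1 := by
  have h := sum_mem_of_forall fun i hi => inv_prime_sub_cube_mem (p := p) hp (i := i) hi
  rw [Finset.sum_add_distrib] at h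
  have e := sum_range_prime_reflect (p := p) fun k => 1 / (k : ℚ) ^ 3
  have e' : ∑ i ∈ Finset.range (p - 1), 1 / ((p : ℚ) - (i + 1)) ^ 3 = genHarmonic 3 (p - 1) := by
    rw [genHarmonic]
    push_cast at e
    rw [← e]
    refine Finset.sum_congr rfl fun i hi => ?_
    rw [cast_prime_sub_succ (Finset.mem_range.mp hi)]
  rw [e'] at h
  refine of_natCast_mul_mem (n := 2) (coprime_of_lt hp (by omega) (by omega)) (by omega)
    (of_eq h ?_)
  rw [genHarmonic]; push_cast; ring

/-- `H_{p-1} ≡ -(p/2) H_{p-1}^{(2)}` modulo `p³`. -/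
theorem two_mul_genHarmonic_one_add_mem (hp : p.Prime) (hp3 : 3 < p) :
    2 * genHarmonic 1 (p - 1) + p * genHarmonic 2 (p - 1) ∈ padicBall p 3 := by
  have h : ∀ i < p - 1, ((p : ℚ) - (i + 1))⁻¹ + ((i : ℚ) + 1)⁻¹ + p * (1 / ((i : ℚ) + 1) ^ 2) +
      p ^ 2 * (1 / ((i : ℚ) + 1) ^ 3) ∈ padicBall p 3 := by
    intro i hi
    refine of_eq (mul_mem_right (pow_mem_ball (p := p) (r := 3))
      (mul_mem_left (pow_mem_zero (inv_succ_mem hp hi) 3) (inv_prime_sub_succ_mem hp hi))) ?_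
    have := prime_sub_succ_ne_zero hi
    field_simp
    ring
  have h := sum_mem_of_forall h
  simp only [Finset.sum_add_distrib, ← Finset.mul_sum] at h
  have e := sum_range_prime_reflect (p := p) fun k => (k : ℚ)⁻¹
  have e' : ∑ i ∈ Finset.range (p - 1), ((p : ℚ) - (i + 1))⁻¹ = genHarmonic 1 (p - 1) := by
    simp only [genHarmonic, one_div, pow_one]
    push_cast at e
    rw [← e]
    refine Finset.sum_congr rfl fun i hi => ?_
    rw [cast_prime_sub_succ (Finset.mem_range.mp hi)]
  rw [e'] at h
  refine of_eq (sub_mem h (pow_mul_mem 2 (genHarmonic_three_mem hp hp3))) ?_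
  simp only [genHarmonic, one_div, pow_one]
  ring

end Harmonic

/-! ### Reflection and doubling of harmonic sums -/

section Reflection

open padicBall

variable {p : ℕ}

/-- The alternating generalized harmonic number `∑_{i=1}^n (-1)^i / i^s`. -/
def altGenHarmonic (s n : ℕ) : ℚ := ∑ i ∈ Finset.range n, (-1) ^ (i + 1) / ((i : ℚ) + 1) ^ s

theorem odd_of_three_lt (hp : p.Prime) (hp3 : 3 < p) : Odd p := hp.odd_of_ne_two (by omega)

theorem neg_one_pow_prime_sub (hp : Odd p) {i : ℕ} (hi : i < p - 1) :
    (-1 : ℚ) ^ (p - (i + 1)) = -(-1) ^ (i + 1) := by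
  have h : (-1 : ℚ) ^ (p - (i + 1)) * (-1) ^ (i + 1) = -1 := by
    rw [← pow_add, Nat.sub_add_cancel (by omega), hp.neg_one_pow]
  have h2 : (-1 : ℚ) ^ (i + 1) * (-1) ^ (i + 1) = 1 := by
    rw [← mul_pow]; simp
  linear_combination (-1 : ℚ) ^ (i + 1) * h - (-1 : ℚ) ^ (p - (i + 1)) * h2

/-- `H*_{p-1}^{(2)} ≡ -p H*_{p-1}^{(3)}` modulo `p²`. -/
theorem altGenHarmonic_two_add_mem (hp : p.Prime) (hp3 : 3 < p) :
    altGenHarmonic 2 (p - 1) + p * altGenHarmonic 3 (p - 1) ∈ padicBall p 2 := by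
  have h : ∀ i < p - 1, (-1) ^ (i + 1) * (1 / ((p : ℚ) - (i + 1)) ^ 2 - 1 / ((i : ℚ) + 1) ^ 2 -
      p * (2 / ((i : ℚ) + 1) ^ 3)) ∈ padicBall p 2 :=
    fun i hi => neg_one_pow_mul_mem _ (inv_prime_sub_sq_mem hp hi)
  have h := sum_mem_of_forall h
  have e := sum_range_prime_reflect (p := p) fun k => (-1) ^ k / (k : ℚ) ^ 2
  have e' : ∑ i ∈ Finset.range (p - 1), (-1) ^ (i + 1) * (1 / ((p : ℚ) - (i + 1)) ^ 2) =
      -altGenHarmonic 2 (p - 1) := by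
    rw [altGenHarmonic, ← Finset.sum_neg_distrib]
    push_cast at e
    rw [Finset.sum_neg_distrib, ← e, ← Finset.sum_neg_distrib]
    refine Finset.sum_congr rfl fun i hi => ?_
    have hi := Finset.mem_range.mp hi
    rw [cast_prime_sub_succ hi, neg_one_pow_prime_sub (odd_of_three_lt hp hp3) hi]
    ring
  simp only [mul_sub, Finset.sum_sub_distrib] at h
  rw [e'] at h
  have e2 : ∑ i ∈ Finset.range (p - 1), (-1) ^ (i + 1) * (1 / ((i : ℚ) + 1) ^ 2) =
      altGenHarmonic 2 (p - 1) := Finset.sum_congr rfl fun i _ => by ring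
  have e3 : ∑ i ∈ Finset.range (p - 1), (-1) ^ (i + 1) * (p * (2 / ((i : ℚ) + 1) ^ 3)) =
      2 * p * altGenHarmonic 3 (p - 1) := by
    rw [altGenHarmonic, Finset.mul_sum]
    exact Finset.sum_congr rfl fun i _ => by ring
  rw [e2, e3] at h
  refine of_natCast_mul_mem (n := 2) (coprime_of_lt hp (by omega) (by omega)) (by omega)
    (of_eq (neg_mem h) ?_)
  push_cast
  ring

/-- Reflection of partial harmonic sums modulo `p`: if `1/(p-i)^s ≡ ε/i^s` and the complete sum
vanishes, then `H_{p-1-k} ≡ -ε H_k`. -/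
theorem genHarmonic_prime_sub {s : ℕ} {ε : ℚ}
    (hs : ∀ i < p - 1, 1 / ((p : ℚ) - (i + 1)) ^ s - ε / ((i : ℚ) + 1) ^ s ∈ padicBall p 1)
    (hH : genHarmonic s (p - 1) ∈ padicBall p 1) {i : ℕ} (hi : i < p - 1) :
    genHarmonic s (p - (i + 1) - 1) + ε * genHarmonic s (i + 1) ∈ padicBall p 1 := by
  induction i with
  | zero =>
    have h := genHarmonic_succ s (p - (0 + 1) - 1)
    rw [show p - (0 + 1) - 1 + 1 = p - 1 by omega] at h
    have e : ((p - (0 + 1) - 1 : ℕ) : ℚ) + 1 = p - ((0 : ℕ) + 1) := by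
      have := cast_prime_sub_succ hi
      rw [← this]
      exact_mod_cast (by omega)
    refine of_eq (sub_mem hH (hs 0 hi)) ?_
    rw [h, e, genHarmonic_succ, genHarmonic_zero]
    ring
  | succ i ih =>
    have h := genHarmonic_succ s (p - (i + 1 + 1) - 1)
    rw [show p - (i + 1 + 1) - 1 + 1 = p - (i + 1) - 1 by omega] at h
    have e : ((p - (i + 1 + 1) - 1 : ℕ) : ℚ) + 1 = p - ((i + 1 : ℕ) + 1) := by
      have := cast_prime_sub_succ hi
      rw [← this]
      exact_mod_cast (by omega)
    refine of_eq (sub_mem (ih (by omega)) (hs (i + 1) hi)) ?_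
    rw [h, e, genHarmonic_succ s (i + 1)]
    ring

theorem sum_range_two_mul {M : Type*} [AddCommMonoid M] (g : ℕ → M) (h : ℕ) :
    ∑ i ∈ Finset.range (2 * h), g i =
      ∑ j ∈ Finset.range h, g (2 * j + 1) + ∑ j ∈ Finset.range h, g (2 * j) := by
  induction h with
  | zero => simp
  | succ h ih =>
    rw [show 2 * (h + 1) = 2 * h + 1 + 1 by ring, Finset.sum_range_succ, Finset.sum_range_succ, ih,
      Finset.sum_range_succ, Finset.sum_range_succ]
    abel

/-- Pairing each `k ≤ h` with `2h + 1 - k`. -/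
theorem sum_range_pair_reflect {M : Type*} [AddCommMonoid M] (g : ℕ → M) (h : ℕ) :
    ∑ i ∈ Finset.range (2 * h), g (i + 1) =
      ∑ i ∈ Finset.range h, (g (i + 1) + g (2 * h + 1 - (i + 1))) := by
  rw [two_mul, Finset.sum_range_add, Finset.sum_add_distrib]
  congr 1
  rw [← Finset.sum_range_reflect]
  refine Finset.sum_congr rfl fun i hi => ?_
  have := Finset.mem_range.mp hi
  congr 1
  omega

/-- Pairing each even number `2j` with the odd number `2h + 1 - 2j`. -/
theorem sum_range_even_reflect {M : Type*} [AddCommMonoid M] (g : ℕ → M) (h : ℕ) :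
    ∑ i ∈ Finset.range (2 * h), g (i + 1) =
      ∑ j ∈ Finset.range h, (g (2 * (j + 1)) + g (2 * h + 1 - (2 * (j + 1)))) := by
  rw [sum_range_two_mul (fun i => g (i + 1)), Finset.sum_add_distrib]
  congr 1
  rw [← Finset.sum_range_reflect]
  refine Finset.sum_congr rfl fun i hi => ?_
  have := Finset.mem_range.mp hi
  congr 1
  omega

/-- If `g(p - k) ≡ g(k) + p g'(k)` modulo `p²`, and `g`, `g'` are multiplied by `c`, `c'` when the
argument is doubled, then comparing the pairings `k ↔ p - k` over `k ≤ p / 2` and over even `k`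
determines the sum of `g` in terms of the half sum of `g'`. -/
theorem doubling_mem {h : ℕ} (hph : p = 2 * h + 1) {g g' : ℕ → ℚ} {c c' : ℚ}
    (hc : c ∈ padicBall p 0)
    (hg : ∀ k, 0 < k → k < p → g (p - k) - g k - p * g' k ∈ padicBall p 2)
    (hgc : ∀ k, g (2 * k) = c * g k) (hgc' : ∀ k, g' (2 * k) = c' * g' k) :
    (1 - c) * ∑ i ∈ Finset.range (p - 1), g (i + 1) -
      (c' - c) * (p * ∑ i ∈ Finset.range h, g' (i + 1)) ∈ padicBall p 2 := by
  have e1 := sum_range_pair_reflect g h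
  have e2 := sum_range_even_reflect g h
  rw [← hph] at e1 e2
  have hp1 : p - 1 = 2 * h := by omega
  have h1 := sum_mem_of_forall (p := p) (r := 2) (n := h)
    (f := fun i => g (p - (i + 1)) - g (i + 1) - p * g' (i + 1))
    fun i hi => hg (i + 1) (by omega) (by omega)
  have h2 := sum_mem_of_forall (p := p) (r := 2) (n := h)
    (f := fun i => g (p - 2 * (i + 1)) - g (2 * (i + 1)) - p * g' (2 * (i + 1)))
    fun i hi => hg (2 * (i + 1)) (by omega) (by omega)
  simp only [hgc, hgc'] at h2 e2
  refine of_eq (sub_mem h2 (mul_mem_left hc h1)) ?_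
  rw [hp1]
  simp only [Finset.sum_sub_distrib, Finset.sum_add_distrib, ← Finset.mul_sum,
    mul_left_comm _ c'] at h1 h2 e1 e2 ⊢
  linear_combination e2 - c * e1

/-- `3 H_{p-1}^{(2)} ≡ -p H_{(p-1)/2}^{(3)}` modulo `p²`. -/
theorem three_mul_genHarmonic_two_add_mem (hp : p.Prime) {h : ℕ} (hph : p = 2 * h + 1) :
    3 * genHarmonic 2 (p - 1) + p * genHarmonic 3 h ∈ padicBall p 2 := by
  have h2 : ((2 : ℕ) : ℚ)⁻¹ ∈ padicBall p 0 :=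
    inv_natCast_mem ((Nat.coprime_two_left).2 ⟨h, hph⟩)
  have key := doubling_mem (p := p) hph (g := fun k => 1 / (k : ℚ) ^ 2)
    (g' := fun k => 2 / (k : ℚ) ^ 3) (c := 1 / 4) (c' := 1 / 8)
    (of_eq (mul_mem_left h2 h2) (by norm_num))
    (by
      intro k hk hkp
      obtain ⟨i, rfl⟩ : ∃ i, k = i + 1 := ⟨k - 1, by omega⟩
      have := inv_prime_sub_sq_mem hp (i := i) (by omega)
      simpa [cast_prime_sub_succ (i := i) (p := p) (by omega)] using this)
    (fun k => by push_cast; rw [mul_pow]; ring) (fun k => by push_cast; rw [mul_pow]; ring)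
  refine of_eq (mul_mem_left (ofNat_mem 4) key) ?_
  have e : ∑ i ∈ Finset.range h, 2 / ((i + 1 : ℕ) : ℚ) ^ 3 = 2 * genHarmonic 3 h := by
    rw [genHarmonic, Finset.mul_sum]
    refine Finset.sum_congr rfl fun i _ => ?_
    push_cast; ring
  rw [e]
  simp only [genHarmonic]
  push_cast
  ring

theorem genHarmonic_two_mem (hp : p.Prime) (hp3 : 3 < p) :
    genHarmonic 2 (p - 1) ∈ padicBall p 1 := by
  obtain ⟨h, hph⟩ := odd_of_three_lt hp hp3
  refine of_natCast_mul_mem (n := 3) (coprime_of_lt hp (by omega) (by omega)) (by omega)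
    (of_eq (sub_mem (mono (by omega) (three_mul_genHarmonic_two_add_mem hp hph))
      (mul_mem_right self_mem_one (genHarmonic_mem hp 3 (n := h) (by omega)))) ?_)
  push_cast
  ring

theorem genHarmonic_one_mem (hp : p.Prime) (hp3 : 3 < p) :
    genHarmonic 1 (p - 1) ∈ padicBall p 2 := by
  refine of_natCast_mul_mem (n := 2) (coprime_of_lt hp (by omega) (by omega)) (by omega)
    (of_eq (sub_mem (mono (by omega) (two_mul_genHarmonic_one_add_mem hp hp3))
      (self_mul_mem (genHarmonic_two_mem hp hp3))) ?_)
  push_cast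
  ring

/-- `4 H*_{p-1}^{(3)} ≡ H_{(p-1)/2}^{(3)}` modulo `p`. -/
theorem four_mul_altGenHarmonic_three_sub_mem (hp : p.Prime) {h : ℕ} (hph : p = 2 * h + 1) :
    4 * altGenHarmonic 3 (p - 1) - genHarmonic 3 h ∈ padicBall p 1 := by
  have e := sum_range_even_reflect (fun k => (-1) ^ k / (k : ℚ) ^ 3) h
  rw [← hph, show 2 * h = p - 1 by omega] at e
  have hterm : ∀ j < h, -4 * (1 / ((p : ℚ) - ((2 * j + 1 : ℕ) + 1)) ^ 3 +
      1 / (((2 * j + 1 : ℕ) : ℚ) + 1) ^ 3) ∈ padicBall p 1 := fun j hj =>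
    mul_mem_left (of_eq (intCast_mem (-4)) (by norm_num))
      (inv_prime_sub_cube_mem hp (i := 2 * j + 1) (by omega))
  have hs := sum_mem_of_forall hterm
  refine of_eq hs ?_
  have e' : altGenHarmonic 3 (p - 1) =
      ∑ i ∈ Finset.range (p - 1), (-1) ^ (i + 1) / ((i + 1 : ℕ) : ℚ) ^ 3 := by
    rw [altGenHarmonic]; push_cast; rfl
  rw [e', e, genHarmonic, Finset.mul_sum, ← Finset.sum_sub_distrib]
  refine Finset.sum_congr rfl fun j hj => ?_
  have hj := Finset.mem_range.mp hj
  have hsgn := neg_one_pow_prime_sub (p := p) ⟨h, hph⟩ (i := 2 * j + 1) (by omega)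
  have hcast := cast_prime_sub_succ (p := p) (i := 2 * j + 1) (by omega)
  rw [show 2 * (j + 1) = 2 * j + 1 + 1 by ring, hsgn, hcast]
  have hev : (-1 : ℚ) ^ (2 * j + 1 + 1) = 1 := Even.neg_one_pow ⟨j + 1, by ring⟩
  rw [hev]
  push_cast
  have : (j : ℚ) + 1 ≠ 0 := by positivity
  have e3 : (1 : ℚ) / (j + 1) ^ 3 = 8 / (2 * j + 1 + 1) ^ 3 := by
    rw [show (2 * j + 1 + 1 : ℚ) = 2 * (j + 1) by ring, mul_pow]
    field_simp; norm_num
  rw [e3]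
  ring

theorem four_mul_altGenHarmonic_three_add_mem (hp : p.Prime) (hp3 : 3 < p) :
    4 * (p * altGenHarmonic 3 (p - 1)) + 3 * genHarmonic 2 (p - 1) ∈ padicBall p 2 := by
  obtain ⟨h, hph⟩ := odd_of_three_lt hp hp3
  exact of_eq (add_mem (self_mul_mem (four_mul_altGenHarmonic_three_sub_mem hp hph))
    (three_mul_genHarmonic_two_add_mem hp hph)) (by ring)

/-- The difference of the two alternating double harmonic sums of weight three vanishes modulo
`p`, because its terms are odd under `k ↦ p - k`. -/
theorem alt_double_sum_mem (hp : p.Prime) (hp3 : 3 < p) :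
    ∑ i ∈ Finset.range (p - 1), (-1) ^ (i + 1) *
      (genHarmonic 2 i / ((i : ℚ) + 1) - genHarmonic 1 i / ((i : ℚ) + 1) ^ 2) ∈
      padicBall p 1 := by
  set w : ℕ → ℚ := fun k => (-1) ^ k *
    (genHarmonic 2 (k - 1) / (k : ℚ) - genHarmonic 1 (k - 1) / (k : ℚ) ^ 2) with hw
  have hsum : ∑ i ∈ Finset.range (p - 1), (-1) ^ (i + 1) *
      (genHarmonic 2 i / ((i : ℚ) + 1) - genHarmonic 1 i / ((i : ℚ) + 1) ^ 2) =
      ∑ i ∈ Finset.range (p - 1), w (i + 1) := by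
    refine Finset.sum_congr rfl fun i _ => ?_
    simp [hw]
  rw [hsum]
  have hterm : ∀ i < p - 1, w (p - (i + 1)) + w (i + 1) ∈ padicBall p 1 := by
    intro i hi
    have h1 := genHarmonic_prime_sub (s := 1) (ε := -1)
      (fun j hj => of_eq (inv_prime_sub_add_mem hp hj) (by simp; ring))
      (mono (by omega) (genHarmonic_one_mem hp hp3)) hi
    have h2 := genHarmonic_prime_sub (s := 2) (ε := 1)
      (fun j hj => of_eq (add_mem (mono (by omega) (inv_prime_sub_sq_mem hp hj))
        (mul_mem_right self_mem_one (mul_mem_left (ofNat_mem 2)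
          (pow_mem_zero (inv_succ_mem hp hj) 3)))) (by simp only [inv_pow]; ring))
      (genHarmonic_two_mem hp hp3) hi
    have hu := inv_succ_mem hp hi
    have hv := inv_prime_sub_succ_mem hp hi
    have huv := inv_prime_sub_add_mem hp hi
    have hH1 := genHarmonic_mem hp 1 (n := i + 1) (by omega)
    have hH2 := genHarmonic_mem hp 2 (n := i + 1) (by omega)
    set u := ((i : ℚ) + 1)⁻¹ with hu'
    set v := ((p : ℚ) - (i + 1))⁻¹ with hv'
    have e1 : w (i + 1) = (-1) ^ (i + 1) *
        ((genHarmonic 2 (i + 1) - u ^ 2) * u - (genHarmonic 1 (i + 1) - u) * u ^ 2) := by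
      rw [genHarmonic_succ, genHarmonic_succ, hw, hu']
      simp only [Nat.add_sub_cancel]
      push_cast
      field_simp
      ring
    have e2 : w (p - (i + 1)) = -(-1) ^ (i + 1) *
        (genHarmonic 2 (p - (i + 1) - 1) * v - genHarmonic 1 (p - (i + 1) - 1) * v ^ 2) := by
      simp only [hw]
      rw [neg_one_pow_prime_sub (odd_of_three_lt hp hp3) hi, cast_prime_sub_succ hi, hv',
        inv_pow, div_eq_mul_inv, div_eq_mul_inv]
    rw [e1, e2]
    have := neg_one_pow_mul_mem (i + 1) (add_mem (sub_mem (mul_mem_right h1 (pow_mem_zero hv 2))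
      (mul_mem_right h2 hv))
      (mul_mem_right huv (add_mem hH2 (mul_mem_left hH1 (sub_mem hv hu)))))
    refine of_eq this ?_
    ring
  have h := sum_mem_of_forall hterm
  rw [Finset.sum_add_distrib, sum_range_prime_reflect] at h
  refine of_natCast_mul_mem (n := 2) (coprime_of_lt hp (by omega) (by omega)) (by omega)
    (of_eq h ?_)
  push_cast
  ring

end Reflection

/-! ### Bernoulli numbers -/

section Bernoulli

open padicBall

variable {p : ℕ}

theorem bernoulli_mem (hp : p.Prime) {i : ℕ} (hi : i + 1 < p) :
    bernoulli i ∈ padicBall p 0 := by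
  induction i using Nat.strong_induction_on with
  | _ i ih =>
    have h := sum_bernoulli (i + 1)
    rw [Finset.sum_range_succ] at h
    refine of_natCast_mul_mem (n := i + 1) (coprime_of_lt hp (by omega) hi) (by omega) ?_
    have h1 : ∑ k ∈ Finset.range i, ((i + 1).choose k : ℚ) * bernoulli k ∈ padicBall p 0 :=
      sum_mem_of_forall fun k hk => mul_mem_left (natCast_mem _) (ih k hk (by omega))
    have h2 : (if i + 1 = 1 then (1 : ℚ) else 0) ∈ padicBall p 0 := by
      split_ifs
      · exact one_mem
      · exact zero_mem _
    refine of_eq (sub_mem h2 h1) ?_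
    rw [← h]
    simp [Nat.choose_succ_self_right]

/-- `∑_{k<p} k^{p-3} ≡ p B_{p-3}` modulo `p²`. -/
theorem sum_pow_sub_mul_bernoulli_mem (hp : p.Prime) (hp3 : 3 < p) :
    ∑ i ∈ Finset.range (p - 1), ((i + 1 : ℕ) : ℚ) ^ (p - 3) - p * bernoulli (p - 3) ∈
      padicBall p 2 := by
  have h := sum_range_pow p (p - 3)
  have hp' : p = p - 1 + 1 := by omega
  have e : ∑ k ∈ Finset.range p, (k : ℚ) ^ (p - 3) =
      ∑ i ∈ Finset.range (p - 1), ((i + 1 : ℕ) : ℚ) ^ (p - 3) := by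
    conv_lhs => rw [hp', Finset.sum_range_succ']
    rw [Nat.cast_zero, zero_pow (by omega), add_zero]
    rfl
  rw [← e, h, Finset.sum_range_succ]
  have hlast : bernoulli (p - 3) * ((p - 3 + 1).choose (p - 3) : ℚ) *
      (p : ℚ) ^ (p - 3 + 1 - (p - 3)) / ((p - 3 : ℕ) + 1) = p * bernoulli (p - 3) := by
    rw [Nat.choose_succ_self_right, Nat.add_sub_cancel_left]
    push_cast
    field_simp
  rw [hlast, add_sub_cancel_right]
  refine sum_mem_of_forall fun i hi => ?_
  have hinv : ((p - 3 + 1 : ℕ) : ℚ)⁻¹ ∈ padicBall p 0 :=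
    inv_natCast_mem (coprime_of_lt hp (by omega) (by omega))
  have hpow : (p : ℚ) ^ (p - 3 + 1 - i) ∈ padicBall p 2 := mono (by omega) pow_mem_ball
  refine of_eq (mul_mem_right hpow (mul_mem_left (mul_mem_left
    (bernoulli_mem hp (i := i) (by omega)) (natCast_mem ((p - 3 + 1).choose i))) hinv)) ?_
  push_cast
  ring

theorem pow_prime_sub_one_sub_one_mem (hp : p.Prime) {k : ℕ} (h0 : 0 < k) (hk : k < p) :
    (k : ℚ) ^ (p - 1) - 1 ∈ padicBall p 1 := by
  have h := Int.ModEq.pow_card_sub_one_eq_one hp (n := (k : ℤ))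
    (by exact_mod_cast Nat.isCoprime_iff_coprime.2 (coprime_of_lt hp h0 hk))
  have h' := intCast_mem_pow (p := p) (r := 1) (n := (k : ℤ) ^ (p - 1) - 1)
    (by simpa using h.symm.dvd)
  exact_mod_cast h'

/-- `(p - k)^n ≡ k^n - n p k^(n-1)` modulo `p²` for even `n`. -/
theorem prime_sub_pow_mem {n k : ℕ} (hn : Even n) (hk : k ≤ p) :
    ((p - k : ℕ) : ℚ) ^ n - (k : ℚ) ^ n - p * (-n * (k : ℚ) ^ (n - 1)) ∈ padicBall p 2 := by
  obtain ⟨c, hc⟩ := Polynomial.powAddExpansion (k : ℤ) (-(p : ℤ)) n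
  refine of_eq (intCast_mem_pow (p := p) (r := 2) (n := c * (p : ℤ) ^ 2) (dvd_mul_left _ _)) ?_
  have hc' := congrArg (Int.cast : ℤ → ℚ) hc
  push_cast at hc' ⊢
  rw [Nat.cast_sub hk, ← hn.neg_pow, neg_sub, sub_eq_add_neg (k : ℚ) p, hc']
  ring

/-- `3 H_{p-1}^{(2)} ≡ 2 p B_{p-3}` modulo `p²`. -/
theorem three_mul_genHarmonic_two_sub_bernoulli_mem (hp : p.Prime) (hp3 : 3 < p) :
    3 * genHarmonic 2 (p - 1) - 2 * (p * bernoulli (p - 3)) ∈ padicBall p 2 := by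
  obtain ⟨h, hph⟩ := odd_of_three_lt hp hp3
  have hB := sum_pow_sub_mul_bernoulli_mem hp hp3
  have hH := three_mul_genHarmonic_two_add_mem hp hph
  have hD := doubling_mem (p := p) hph (g := fun k => (k : ℚ) ^ (p - 3))
    (g' := fun k => -((p - 3 : ℕ) : ℚ) * (k : ℚ) ^ (p - 3 - 1))
    (c := 2 ^ (p - 3)) (c' := 2 ^ (p - 3 - 1))
    (pow_mem_zero (ofNat_mem 2) _)
    (fun k _ hk => prime_sub_pow_mem ⟨h - 1, by omega⟩ hk.le)
    (fun k => by push_cast; rw [mul_pow]) (fun k => by push_cast; rw [mul_pow]; ring)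
  set S := ∑ i ∈ Finset.range (p - 1), ((i + 1 : ℕ) : ℚ) ^ (p - 3) with hS
  set β := ∑ i ∈ Finset.range h, ((i + 1 : ℕ) : ℚ) ^ (p - 3 - 1) with hβ
  have hβH : β - genHarmonic 3 h ∈ padicBall p 1 := by
    rw [hβ, genHarmonic, ← Finset.sum_sub_distrib]
    refine sum_mem_of_forall fun i hi => ?_
    have hu := inv_succ_mem hp (i := i) (by omega)
    refine of_eq (mul_mem_right (pow_prime_sub_one_sub_one_mem hp (Nat.succ_pos i) (by omega))
      (pow_mem_zero hu 3)) ?_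
    rw [show p - 1 = p - 3 - 1 + 3 by omega, pow_add]
    push_cast
    have : (i : ℚ) + 1 ≠ 0 := by positivity
    field_simp
  have hβ0 : β ∈ padicBall p 0 := sum_mem_of_forall fun i _ => pow_mem_zero (natCast_mem _) _
  have hS1 : S ∈ padicBall p 1 :=
    of_eq (add_mem (mono (by omega) hB) (mul_mem_right self_mem_one
      (bernoulli_mem hp (i := p - 3) (by omega)))) (by ring)
  have h2 : (8 : ℚ) * 2 ^ (p - 3 - 1) - 1 ∈ padicBall p 1 := by
    have := pow_prime_sub_one_sub_one_mem hp (k := 2) (by omega) (by omega)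
    rw [show p - 1 = p - 3 - 1 + 3 by omega, pow_add] at this
    exact of_eq this (by push_cast; ring)
  have hpow : (2 : ℚ) ^ (p - 3) = 2 * 2 ^ (p - 3 - 1) := by
    rw [← pow_succ', show p - 3 - 1 + 1 = p - 3 by omega]
  have hn : ((p - 3 : ℕ) : ℚ) = p - 3 := by rw [Nat.cast_sub (by omega)]; norm_num
  rw [hpow, ← Finset.mul_sum, ← hβ, hn] at hD
  set t : ℚ := 2 ^ (p - 3 - 1) with ht
  have ht0 : t ∈ padicBall p 0 := pow_mem_zero (ofNat_mem 2) _
  -- modulo `p` one has `8 t ≡ 1`; substitute this in the doubling relation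
  have key : 6 * S + 3 * (p * β) ∈ padicBall p 2 := by
    have a1 := mul_mem_left (ofNat_mem 8) hD
    have a2 : 2 * (8 * t - 1) * S ∈ padicBall p 2 :=
      mul_mem_add (mul_mem_left (ofNat_mem 2) h2) hS1
    have a3 : (8 * t - 1) * (3 * (p * β)) ∈ padicBall p 2 :=
      mul_mem_add h2 (mul_mem_left (ofNat_mem 3) (mul_mem_right self_mem_one hβ0))
    have a4 : (p : ℚ) ^ 2 * (8 * t * β) ∈ padicBall p 2 :=
      mul_mem_right pow_mem_ball (mul_mem_left (mul_mem_left (ofNat_mem 8) ht0) hβ0)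
    exact of_eq (sub_mem (add_mem (add_mem a1 a4) a2) a3)
      (by change _ = 8 * _ + _ + _ - _; ring)
  refine of_natCast_mul_mem (n := 3) (coprime_of_lt hp (by omega) (by omega)) (by omega) ?_
  have b1 := mul_mem_left (ofNat_mem 3) hH
  have b2 := mul_mem_left (ofNat_mem 3) (self_mul_mem hβH)
  have b3 := mul_mem_left (ofNat_mem 6) hB
  exact of_eq (add_mem (sub_mem (add_mem b1 b2) key) b3) (by push_cast; ring)

end Bernoulli

/-! ### Coefficients modulo powers of a prime -/

section Coefficients

open padicBall

variable {p : ℕ}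

theorem ratCatalan_mem (k : ℕ) : ratCatalan k ∈ padicBall p 0 := by
  refine of_eq (natCast_mem (catalan k)) ?_
  have h : ((k + 1 : ℕ) : ℚ) * catalan k = k.centralBinom := by
    exact_mod_cast succ_mul_catalan_eq_centralBinom k
  rw [ratCatalan, ← h]
  push_cast
  field_simp

theorem ratCatalan_mem_one (hp : p.Prime) {k : ℕ} (h1 : p ≤ 2 * k) (h2 : k + 1 < p) :
    ratCatalan k ∈ padicBall p 1 := by
  have hdvd : p ∣ k.centralBinom := by
    rw [Nat.centralBinom]
    exact hp.dvd_choose (by omega) (by omega) h1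
  have hinv : ((k + 1 : ℕ) : ℚ)⁻¹ ∈ padicBall p 0 :=
    inv_natCast_mem (coprime_of_lt hp (by omega) h2)
  refine of_eq (mul_mem_right (natCast_mem_one hdvd) hinv) ?_
  rw [ratCatalan]
  push_cast
  ring

theorem sqProd_succ (N k : ℕ) :
    sqProd N (k + 1) = sqProd N k * (1 - (N : ℚ) ^ 2 / (k + 1) ^ 2) := by
  rw [sqProd, Finset.prod_range_succ, ← sqProd]

theorem sqProd_sub_mem (hp : p.Prime) {k : ℕ} (hk : k ≤ p - 1) :
    sqProd p k - (1 - p ^ 2 * genHarmonic 2 k) ∈ padicBall p 4 := by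
  induction k with
  | zero => exact of_eq (zero_mem _) (by simp [sqProd, genHarmonic])
  | succ k ih =>
    have hu := pow_mem_zero (inv_succ_mem hp (i := k) (by omega)) 2
    have hfac : 1 - (p : ℚ) ^ 2 * ((k : ℚ) + 1)⁻¹ ^ 2 ∈ padicBall p 0 :=
      sub_mem one_mem (mul_mem_left (pow_mem_zero (natCast_mem p) 2) hu)
    have h1 := mul_mem_right (ih (by omega)) hfac
    have h2 : (p : ℚ) ^ 4 * (((k : ℚ) + 1)⁻¹ ^ 2 * genHarmonic 2 k) ∈ padicBall p 4 :=
      mul_mem_right pow_mem_ball (mul_mem_left hu (genHarmonic_mem hp 2 (by omega)))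
    refine of_eq (add_mem h1 h2) ?_
    rw [sqProd_succ, genHarmonic_succ, div_eq_mul_inv, one_div, inv_pow]
    ring

theorem centralBinom_prime (hp : p.Prime) (hp3 : 3 < p) :
    (p.centralBinom : ℚ) = 2 * sqProd p (p - 1) := by
  obtain ⟨m, hm⟩ := odd_of_three_lt hp hp3
  have h1 := choose_mul_centralBinom_eq_sqProd p (p - 1)
  have h2 := centralBinom_succ_cast (p - 1)
  rw [show p + (p - 1) = 2 * (p - 1) + 1 by omega, Nat.choose_self,
    Even.neg_one_pow (show Even (p - 1) from ⟨m, by omega⟩)] at h1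
  rw [show p - 1 + 1 = p by omega] at h2
  have hp0 : (p : ℚ) ≠ 0 := by exact_mod_cast hp.ne_zero
  have hc : ((p - 1 : ℕ) : ℚ) + 1 = p := by exact_mod_cast (by omega)
  rw [hc] at h2
  apply mul_left_cancel₀ hp0
  push_cast at h1
  linear_combination h2 + 2 * h1

/-- Wolstenholme's congruence `C(2p,p) ≡ 2` modulo `p³`. -/
theorem centralBinom_prime_sub_two_mem (hp : p.Prime) (hp3 : 3 < p) :
    (p.centralBinom : ℚ) - 2 ∈ padicBall p 3 := by
  have h1 := mono (show 3 ≤ 4 by omega) (sqProd_sub_mem hp (le_refl (p - 1)))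
  have h2 := pow_mul_mem 2 (genHarmonic_two_mem hp hp3)
  refine of_eq (mul_mem_left (ofNat_mem 2) (sub_mem h1 h2)) ?_
  rw [centralBinom_prime hp hp3]
  change _ = 2 * _
  ring

theorem choose_prime_sub_one_mem (hp : p.Prime) {i : ℕ} (hi : i < p) :
    ((p - 1).choose i : ℚ) - (-1) ^ i * (1 - p * genHarmonic 1 i) ∈ padicBall p 2 := by
  induction i with
  | zero => exact of_eq (zero_mem _) (by simp [genHarmonic])
  | succ i ih =>
    have hu := inv_succ_mem hp (i := i) (by omega)
    have hrec : ((p - 1).choose (i + 1) : ℚ) * (i + 1) = (p - 1).choose i * (p - (i + 1)) := by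
      have := Nat.choose_succ_right_eq (p - 1) i
      rw [show p - 1 - i = p - (i + 1) by omega] at this
      rw [← cast_prime_sub_succ (by omega)]
      exact_mod_cast this
    have h1 := mul_mem_right (ih (by omega))
      (sub_mem (mul_mem_left (natCast_mem p) hu) one_mem)
    have h2 := neg_one_pow_mul_mem i (mul_mem_right (pow_mem_ball (p := p) (r := 2))
      (mul_mem_left hu (genHarmonic_mem hp 1 (n := i) (by omega))))
    refine of_eq (sub_mem h1 h2) ?_
    have hne : (i : ℚ) + 1 ≠ 0 := by positivity
    rw [← eq_div_iff hne] at hrec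
    rw [hrec, genHarmonic_succ]
    field_simp
    ring

/-- The number `1 - 2p/k + 2p² (1/k² - H_{k-1}^{(2)} + H_{k-1}/k)` for `k = i + 1`, which is modulo
`p³` equal to `(-1)^i` times the coefficient of degree `p + i` in `catalanPoly 1 p`. -/
def highCoeff (p i : ℕ) : ℚ :=
  1 - 2 * p * ((i : ℚ) + 1)⁻¹ + 2 * p ^ 2 *
    (((i : ℚ) + 1)⁻¹ ^ 2 - genHarmonic 2 i + genHarmonic 1 i * ((i : ℚ) + 1)⁻¹)

theorem coeff_catalanPoly_one_add_mem (hp : p.Prime) (hp3 : 3 < p) {i : ℕ} (hi : i < p - 1) :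
    (catalanPoly 1 p).coeff (p + i) - (-1) ^ i * highCoeff p i ∈ padicBall p 3 := by
  obtain ⟨h, hph⟩ := odd_of_three_lt hp hp3
  have hp0 : (p : ℚ) ≠ 0 := by exact_mod_cast hp.ne_zero
  have hC := centralBinom_prime_sub_two_mem hp hp3
  have hrec : ∀ j, ((p : ℚ) + j + 1) * (p + j) * ((catalanPoly 1 p).coeff (p + j) +
      (catalanPoly 1 p).coeff (p - 1 + j)) = p * p.centralBinom * (p - 1).choose j := by
    intro j
    have hr := coeff_catalanPoly_one_recurrence (p - 1) (p - 1 + j)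
    rw [if_pos (by omega), show p - 1 + j - (p - 1) = j by omega, show p - 1 + 1 = p by omega,
      show p - 1 + j + 1 = p + j by omega,
      Even.neg_one_pow (show Even (p - 1) from ⟨h, by omega⟩), Nat.cast_add,
      Nat.cast_sub hp.one_le] at hr
    push_cast at hr
    linear_combination hr
  induction i with
  | zero =>
    have hr := hrec 0
    rw [add_zero, add_zero, coeff_catalanPoly_one_of_lt (K := p) (m := p - 1) (by omega),
      Even.neg_one_pow (show Even (p - 1) from ⟨h, by omega⟩)] at hr
    have hu := inv_prime_add_succ_mem hp (i := 0) (by omega)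
    have h1 := mul_mem_right hC hu
    have h2 := mul_mem_right (pow_mem_ball (p := p) (r := 3)) (mul_mem_left (ofNat_mem 2) hu)
    have hne : (p : ℚ) + 1 ≠ 0 := by positivity
    have hd : (catalanPoly 1 p).coeff p = p.centralBinom / (p + 1) - 1 := by
      rw [eq_sub_iff_add_eq, eq_div_iff hne]
      apply mul_left_cancel₀ hp0
      push_cast at hr
      simp only [Nat.choose_zero_right, Nat.cast_one] at hr
      linear_combination hr
    refine of_eq (sub_mem h1 h2) ?_
    rw [add_zero, hd, highCoeff]
    simp only [genHarmonic_zero, Nat.cast_zero, zero_add, pow_zero, inv_one]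
    change _ = _ - _ * (2 * _)
    field_simp
    ring
  | succ i ih =>
    have hr := hrec (i + 1)
    rw [show p - 1 + (i + 1) = p + i by omega] at hr
    have hu := inv_succ_mem hp (i := i) (by omega)
    have hu' := inv_succ_mem hp (i := i + 1) hi
    have hv := inv_prime_add_succ_mem hp (i := i) (by omega)
    have hv' := inv_prime_add_succ_mem hp (i := i + 1) hi
    have hb := choose_prime_sub_one_mem hp (i := i + 1) (by omega)
    have hH := genHarmonic_mem hp 1 (n := i + 1) (by omega)
    have hn1 : (p : ℚ) + (i + 1) ≠ 0 := by positivity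
    have hn2 : (p : ℚ) + (((i + 1 : ℕ) : ℚ) + 1) ≠ 0 := by positivity
    have hn3 : (i : ℚ) + 1 ≠ 0 := by positivity
    have hn4 : ((i + 1 : ℕ) : ℚ) + 1 ≠ 0 := by positivity
    set u := ((i : ℚ) + 1)⁻¹ with hu_def
    set u' := (((i + 1 : ℕ) : ℚ) + 1)⁻¹ with hu'_def
    set v := ((p : ℚ) + (i + 1))⁻¹ with hv_def
    set v' := ((p : ℚ) + (((i + 1 : ℕ) : ℚ) + 1))⁻¹ with hv'_def
    set d := (catalanPoly 1 p).coeff (p + i)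
    set d' := (catalanPoly 1 p).coeff (p + (i + 1))
    set c : ℚ := ((p.centralBinom : ℕ) : ℚ)
    set b : ℚ := (((p - 1).choose (i + 1) : ℕ) : ℚ)
    set H := genHarmonic 1 (i + 1) with hH_def
    have hd : d' = p * c * b * (v * v') - d := by
      rw [hv_def, hv'_def]
      push_cast at hr hn2 ⊢
      have hn2' : (p : ℚ) + (i + 1) + 1 ≠ 0 := by positivity
      field_simp
      linear_combination hr
    have hvu : v = u - p * (u * v) := by rw [hv_def, hu_def]; field_simp; ring
    have hvu' : v' = u' - p * (u' * v') := by rw [hv'_def, hu'_def]; field_simp; ring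
    have huu : u - u' = u * u' := by
      rw [hu_def, hu'_def]; push_cast at hn4 ⊢; field_simp; ring
    -- replace `C(2p,p)`, the binomial coefficient and the two inverses one after the other
    have t1 : (p : ℚ) * (c - 2) * (b * (v * v')) ∈ padicBall p 3 :=
      mono (by omega) (mul_mem_right (self_mul_mem hC)
        (mul_mem_left (natCast_mem _) (mul_mem_left hv hv')))
    have t2 := self_mul_mem (mul_mem_right hb (mul_mem_left (ofNat_mem 2) (mul_mem_left hv hv')))
    have hvv1 : v - u * (1 - p * u) ∈ padicBall p 2 :=
      of_eq (mul_mem_right (pow_mem_ball (r := 2)) (mul_mem_left (pow_mem_zero hu 2) hv)) (by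
        linear_combination (1 - p * u) * hvu)
    have hvv2 : v' - u' * (1 - p * u') ∈ padicBall p 2 :=
      of_eq (mul_mem_right (pow_mem_ball (r := 2)) (mul_mem_left (pow_mem_zero hu' 2) hv')) (by
        linear_combination (1 - p * u') * hvu')
    have hvv : v * v' - u * u' * (1 - p * u - p * u') ∈ padicBall p 2 := by
      have a1 := mul_mem_right hvv1 hv'
      have a2 := mul_mem_left (mul_mem_left hu (sub_mem one_mem
        (mul_mem_left (natCast_mem p) hu))) hvv2
      have a3 := mul_mem_right (pow_mem_ball (p := p) (r := 2))
        (mul_mem_left (pow_mem_zero hu 2) (pow_mem_zero hu' 2))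
      exact of_eq (add_mem (add_mem a1 a2) a3) (by ring)
    have t3 := neg_one_pow_mul_mem (i + 1) (self_mul_mem (mul_mem_left (mul_mem_left (ofNat_mem 2)
      (sub_mem one_mem (mul_mem_left (natCast_mem p) hH))) hvv))
    have t4 : (-1) ^ (i + 1) * ((p : ℚ) ^ 3 * (2 * (H * (u + u') * (u * u')))) ∈ padicBall p 3 :=
      neg_one_pow_mul_mem _ (mul_mem_right pow_mem_ball (mul_mem_left (ofNat_mem 2)
        (mul_mem_left (mul_mem_left hH (add_mem hu hu')) (mul_mem_left hu hu'))))
    have hfin : highCoeff p (i + 1) + 0 = highCoeff p i + 2 * p * (u * u') *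
        (1 - p * H - p * u - p * u') := by
      rw [highCoeff, highCoeff, genHarmonic_succ 2 i, ← hH_def]
      have hH' : genHarmonic 1 i = H - u := by
        rw [hH_def, genHarmonic_succ, hu_def]; simp
      have h2 : 1 / ((i : ℚ) + 1) ^ 2 = u ^ 2 := by rw [hu_def, inv_pow, one_div]
      rw [hH', h2, ← hu_def, ← hu'_def]
      linear_combination (2 * p - 2 * p ^ 2 * H - 2 * p ^ 2 * (u + u')) * huu
    have ih' := ih (by omega)
    refine of_eq (sub_mem (add_mem (add_mem (add_mem t1 t2) t3) t4) ih') ?_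
    change _ = _ + p * (_ * (2 * _)) + (-1 : ℚ) ^ (i + 1) * (p * (2 * _ * _)) + _ - _
    rw [hd]
    linear_combination (-(-1) ^ (i + 1)) * hfin

/-- A term of degree `k` in `x + x²` contributes to a degree `m ≥ p` only if `2k ≥ p`; then `p`
divides the Catalan number, unless `k = p - 1`, where `p` divides the harmonic number instead. -/
theorem coeff_catalanPoly_genHarmonic_two_mem (hp : p.Prime) (hp3 : 3 < p) {m : ℕ} (hm : p ≤ m) :
    (catalanPoly (genHarmonic 2) p).coeff m ∈ padicBall p 1 := by
  rw [coeff_catalanPoly]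
  refine sum_mem_of_forall fun k hk => ?_
  have hite : (if k ≤ m then (k.choose (m - k) : ℚ) else 0) ∈ padicBall p 0 := by
    split_ifs
    · exact natCast_mem _
    · exact zero_mem _
  have hH := genHarmonic_mem hp 2 (n := k) (by omega)
  rcases Nat.lt_or_ge (2 * k) p with h | h
  · rw [if_pos (by omega), Nat.choose_eq_zero_of_lt (by omega), Nat.cast_zero, mul_zero]
    exact zero_mem _
  rcases Nat.lt_or_ge (k + 1) p with h' | h'
  · exact mul_mem_right (mul_mem_left (neg_one_pow_mul_mem k hH) (ratCatalan_mem_one hp h h'))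
      hite
  · obtain rfl : k = p - 1 := by omega
    exact mul_mem_right (mul_mem_right (neg_one_pow_mul_mem _ (genHarmonic_two_mem hp hp3))
      (ratCatalan_mem _)) hite

end Coefficients

/-! ### The integral modulo the fourth power of a prime -/

section Assembly

open padicBall

variable {p : ℕ}

theorem prime_div_succ_mem (hp : p.Prime) {m : ℕ} (hm : m + 1 < 2 * p) :
    (p : ℚ) / (m + 1) ∈ padicBall p 0 := by
  rcases eq_or_ne (m + 1) p with h | h
  · refine of_eq one_mem ?_
    have : ((m : ℚ) + 1) = p := by exact_mod_cast h
    rw [this, div_self (by exact_mod_cast hp.ne_zero)]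
  · have hc : (m + 1).Coprime p := by
      refine ((Nat.Prime.coprime_iff_not_dvd hp).2 ?_).symm
      rintro ⟨c, hc⟩
      have h1 : c < 2 := by
        by_contra hcon
        have : p * 2 ≤ p * c := Nat.mul_le_mul_left p (by omega)
        omega
      interval_cases c <;> omega
    refine of_eq (mul_mem_left (natCast_mem p) (inv_natCast_mem hc)) ?_
    push_cast
    ring

theorem mul_integ_quad_pow_mem (hp : p.Prime) {k : ℕ} (hk : k < p) :
    (p : ℚ) * integ (quad ^ k) ∈ padicBall p 0 := by
  rw [integ_eq_sum_range _ (2 * k + 1) (Nat.lt_succ_of_le (natDegree_quad_pow_le k)),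
    Finset.mul_sum]
  refine sum_mem_of_forall fun m hm => ?_
  have hcoeff : (quad ^ k).coeff m ∈ padicBall p 0 := by
    rw [coeff_quad_pow]
    split_ifs
    · exact natCast_mem _
    · exact zero_mem _
  exact of_eq (mul_mem_left hcoeff (prime_div_succ_mem hp (m := m) (by omega))) (by ring)

theorem integ_catalanPoly (h : ℕ → ℚ) (K : ℕ) :
    integ (catalanPoly h K) =
      ∑ k ∈ Finset.range K, (-1) ^ k * h k * ratCatalan k * integ (quad ^ k) := by
  rw [catalanPoly, map_sum]
  simp only [Polynomial.C_mul', map_smul, smul_eq_mul]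

/-- Modulo `p⁴` the product `sqProd p k` is `1 - p² H_k^{(2)}`; the integrals of the powers of
`x + x²` have at most one factor `p` in the denominator, which the prefactor `p` absorbs. -/
theorem sum_delannoy_mul_schroder_sub_mem (hp : p.Prime) :
    ∑ n ∈ Finset.range p, (delannoyNumber n : ℚ) * schroderNumber n -
      (p * integ (catalanPoly 1 p) - p ^ 3 * integ (catalanPoly (genHarmonic 2) p)) ∈
      padicBall p 4 := by
  have h := sum_mem_of_forall (p := p) (r := 4) (n := p)
    (f := fun k => (-1) ^ k * ((sqProd p k - (1 - p ^ 2 * genHarmonic 2 k)) *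
      (ratCatalan k * (p * integ (quad ^ k))))) fun k hk =>
      neg_one_pow_mul_mem k (mul_mem_right (sqProd_sub_mem hp (by omega))
        (mul_mem_left (ratCatalan_mem k) (mul_integ_quad_pow_mem hp hk)))
  refine of_eq h ?_
  rw [sum_delannoy_mul_schroder, integ_catalanPoly, integ_catalanPoly, Finset.mul_sum,
    Finset.mul_sum, Finset.mul_sum, ← Finset.sum_sub_distrib, ← Finset.sum_sub_distrib]
  refine Finset.sum_congr rfl fun k _ => ?_
  simp only [Pi.one_apply]
  ring

/-- Splitting the integral at the degree `p - 1`, the only one at which a denominator `p` occurs. -/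
theorem integ_catalanPoly_eq (hp : p.Prime) (h : ℕ → ℚ) :
    integ (catalanPoly h p) =
      ∑ i ∈ Finset.range (p - 1), (catalanPoly h p).coeff i / (i + 1) +
      (catalanPoly h p).coeff (p - 1) / p +
      ∑ i ∈ Finset.range (p - 1), (catalanPoly h p).coeff (p + i) / (p + (i + 1)) := by
  have hp1 := hp.one_le
  rw [integ_eq_sum_range _ _ (natDegree_catalanPoly_lt h hp.pos),
    show 2 * p - 1 = (p - 1 + 1) + (p - 1) by omega, Finset.sum_range_add, Finset.sum_range_succ]
  congr 1
  · congr 2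
    rw [Nat.cast_sub hp1]
    push_cast
    ring
  · refine Finset.sum_congr rfl fun i _ => ?_
    rw [show p - 1 + 1 + i = p + i by omega]
    push_cast
    ring

/-- Contribution of the weights `1`. The coefficients are `(-1)^m` up to degree `p - 1` and given by
`highCoeff` beyond, so that the low and the high degrees each yield one copy of `-p H*_{p-1}`. -/
theorem mul_integ_catalanPoly_one_sub_mem (hp : p.Prime) (hp3 : 3 < p) :
    p * integ (catalanPoly 1 p) - (1 - 2 * p * altGenHarmonic 1 (p - 1) +
      3 * p ^ 2 * altGenHarmonic 2 (p - 1) - 5 * p ^ 3 * altGenHarmonic 3 (p - 1) +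
      2 * p ^ 3 * ∑ i ∈ Finset.range (p - 1), (-1) ^ (i + 1) *
        (genHarmonic 2 i / ((i : ℚ) + 1) - genHarmonic 1 i / ((i : ℚ) + 1) ^ 2)) ∈
      padicBall p 4 := by
  obtain ⟨h, hph⟩ := odd_of_three_lt hp hp3
  have hp0 : (p : ℚ) ≠ 0 := by exact_mod_cast hp.ne_zero
  have hlow : ∑ i ∈ Finset.range (p - 1), (catalanPoly 1 p).coeff i / ((i : ℚ) + 1) =
      -altGenHarmonic 1 (p - 1) := by
    rw [altGenHarmonic, ← Finset.sum_neg_distrib]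
    refine Finset.sum_congr rfl fun i hi => ?_
    rw [coeff_catalanPoly_one_of_lt (by have := Finset.mem_range.mp hi; omega)]
    ring
  have hterm : ∀ i < p - 1, (catalanPoly 1 p).coeff (p + i) / ((p : ℚ) + (i + 1)) -
      (-1) ^ i * (1 / ((i : ℚ) + 1) ^ 1 - 3 * p * (1 / ((i : ℚ) + 1) ^ 2) +
        5 * p ^ 2 * (1 / ((i : ℚ) + 1) ^ 3) -
        2 * p ^ 2 * (genHarmonic 2 i / ((i : ℚ) + 1) - genHarmonic 1 i / ((i : ℚ) + 1) ^ 2)) ∈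
      padicBall p 3 := by
    intro i hi
    have hd := coeff_catalanPoly_one_add_mem hp hp3 hi
    have hu := inv_succ_mem hp hi
    have hv := inv_prime_add_succ_mem hp hi
    have hH1 := genHarmonic_mem hp 1 (n := i) (by omega)
    have hH2 := genHarmonic_mem hp 2 (n := i) (by omega)
    have hP := natCast_mem (p := p) p
    have hn1 : (p : ℚ) + (i + 1) ≠ 0 := by positivity
    have hn3 : (i : ℚ) + 1 ≠ 0 := by positivity
    simp only [div_eq_mul_inv, ← inv_pow]
    rw [highCoeff] at hd
    set u := ((i : ℚ) + 1)⁻¹ with hu_def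
    set v := ((p : ℚ) + (i + 1))⁻¹ with hv_def
    have hvu : v = u - p * u ^ 2 + p ^ 2 * u ^ 3 - p ^ 3 * (u ^ 3 * v) := by
      rw [hv_def, hu_def]; field_simp; ring
    have hX : u ^ 2 - genHarmonic 2 i + genHarmonic 1 i * u ∈ padicBall p 0 :=
      add_mem (sub_mem (pow_mem_zero hu 2) hH2) (mul_mem_left hH1 hu)
    set x := u ^ 2 - genHarmonic 2 i + genHarmonic 1 i * u with hx_def
    have hΔ : 1 - 2 * p * u + 2 * p ^ 2 * x ∈ padicBall p 0 :=
      add_mem (sub_mem one_mem (mul_mem_left (mul_mem_left (ofNat_mem 2) hP) hu))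
        (mul_mem_left (mul_mem_left (ofNat_mem 2) (pow_mem_zero hP 2)) hX)
    have t1 := mul_mem_right hd hv
    have t2 : (p : ℚ) ^ 3 * ((1 - 2 * p * u + 2 * p ^ 2 * x) * (u ^ 3 * v)) ∈ padicBall p 3 :=
      mul_mem_right pow_mem_ball (mul_mem_left hΔ (mul_mem_left (pow_mem_zero hu 3) hv))
    have t3 : (p : ℚ) ^ 3 * (u * (2 * (p * (u ^ 2 * x)) - 2 * (u * (x + u ^ 2)))) ∈ padicBall p 3 :=
      mul_mem_right pow_mem_ball (mul_mem_left hu (sub_mem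
        (mul_mem_left (ofNat_mem 2) (mul_mem_left hP (mul_mem_left (pow_mem_zero hu 2) hX)))
        (mul_mem_left (ofNat_mem 2) (mul_mem_left hu (add_mem hX (pow_mem_zero hu 2))))))
    refine of_eq (add_mem t1 (neg_one_pow_mul_mem i (sub_mem t3 t2))) ?_
    linear_combination ((-1 : ℚ) ^ i * (1 - 2 * p * u + 2 * p ^ 2 * x)) * hvu +
      (-1 : ℚ) ^ i * (2 * p ^ 2 * u) * hx_def
  have hs := self_mul_mem (sum_mem_of_forall hterm)
  rw [integ_catalanPoly_eq hp, hlow, coeff_catalanPoly_one_of_lt (by omega),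
    Even.neg_one_pow (show Even (p - 1) from ⟨h, by omega⟩)]
  refine of_eq hs ?_
  have e : ∀ s, ∑ i ∈ Finset.range (p - 1), (-1 : ℚ) ^ i * (1 / ((i : ℚ) + 1) ^ s) =
      -altGenHarmonic s (p - 1) := by
    intro s
    rw [altGenHarmonic, ← Finset.sum_neg_distrib]
    exact Finset.sum_congr rfl fun i _ => by ring
  have e2 : ∑ i ∈ Finset.range (p - 1), (-1 : ℚ) ^ i *
      (genHarmonic 2 i / ((i : ℚ) + 1) - genHarmonic 1 i / ((i : ℚ) + 1) ^ 2) =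
      -∑ i ∈ Finset.range (p - 1), (-1) ^ (i + 1) *
        (genHarmonic 2 i / ((i : ℚ) + 1) - genHarmonic 1 i / ((i : ℚ) + 1) ^ 2) := by
    rw [← Finset.sum_neg_distrib]
    exact Finset.sum_congr rfl fun i _ => by ring
  have hsplit : ∑ i ∈ Finset.range (p - 1), (-1 : ℚ) ^ i *
      (1 / ((i : ℚ) + 1) ^ 1 - 3 * p * (1 / ((i : ℚ) + 1) ^ 2) +
        5 * p ^ 2 * (1 / ((i : ℚ) + 1) ^ 3) -
        2 * p ^ 2 * (genHarmonic 2 i / ((i : ℚ) + 1) - genHarmonic 1 i / ((i : ℚ) + 1) ^ 2)) =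
      -altGenHarmonic 1 (p - 1) + 3 * p * altGenHarmonic 2 (p - 1) -
        5 * p ^ 2 * altGenHarmonic 3 (p - 1) +
        2 * p ^ 2 * ∑ i ∈ Finset.range (p - 1), (-1) ^ (i + 1) *
        (genHarmonic 2 i / ((i : ℚ) + 1) - genHarmonic 1 i / ((i : ℚ) + 1) ^ 2) := by
    have expand : ∀ i : ℕ, (-1 : ℚ) ^ i *
      (1 / ((i : ℚ) + 1) ^ 1 - 3 * p * (1 / ((i : ℚ) + 1) ^ 2) +
        5 * p ^ 2 * (1 / ((i : ℚ) + 1) ^ 3) -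
        2 * p ^ 2 * (genHarmonic 2 i / ((i : ℚ) + 1) - genHarmonic 1 i / ((i : ℚ) + 1) ^ 2)) =
        (-1 : ℚ) ^ i * (1 / ((i : ℚ) + 1) ^ 1) -
        3 * p * ((-1 : ℚ) ^ i * (1 / ((i : ℚ) + 1) ^ 2)) +
        5 * p ^ 2 * ((-1 : ℚ) ^ i * (1 / ((i : ℚ) + 1) ^ 3)) -
        2 * p ^ 2 * ((-1 : ℚ) ^ i *
          (genHarmonic 2 i / ((i : ℚ) + 1) - genHarmonic 1 i / ((i : ℚ) + 1) ^ 2)) := by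
      intro i; ring
    simp only [expand, Finset.sum_add_distrib, Finset.sum_sub_distrib, ← Finset.mul_sum, e, e2]
    ring
  rw [Finset.sum_sub_distrib, hsplit]
  field_simp
  ring

/-- Contribution of the weights `H_k^{(2)}`, where the coefficients of degree at least `p` are
negligible. -/
theorem pow_mul_integ_catalanPoly_genHarmonic_mem (hp : p.Prime) (hp3 : 3 < p) :
    p ^ 3 * integ (catalanPoly (genHarmonic 2) p) -
      (2 * p ^ 2 * genHarmonic 2 (p - 1) - 2 * p * genHarmonic 1 (p - 1) -
      2 * p ^ 3 * ∑ i ∈ Finset.range (p - 1), (-1) ^ (i + 1) *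
        (genHarmonic 2 i / ((i : ℚ) + 1) - genHarmonic 1 i / ((i : ℚ) + 1) ^ 2)) ∈
      padicBall p 4 := by
  obtain ⟨h, hph⟩ := odd_of_three_lt hp hp3
  have hp0 : (p : ℚ) ≠ 0 := by exact_mod_cast hp.ne_zero
  have hcoeff : ∀ m ≤ p - 1, (catalanPoly (genHarmonic 2) p).coeff m =
      2 * (-1) ^ m * (genHarmonic 2 m - genHarmonic 1 m / (m + 1)) := by
    intro m hm
    have := coeff_catalanPoly_genHarmonic_two hm
    rwa [show p - 1 + 1 = p by omega] at this
  have hlow : ∑ i ∈ Finset.range (p - 1),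
      (catalanPoly (genHarmonic 2) p).coeff i / ((i : ℚ) + 1) =
      -2 * ∑ i ∈ Finset.range (p - 1), (-1) ^ (i + 1) *
        (genHarmonic 2 i / ((i : ℚ) + 1) - genHarmonic 1 i / ((i : ℚ) + 1) ^ 2) := by
    rw [Finset.mul_sum]
    refine Finset.sum_congr rfl fun i hi => ?_
    rw [hcoeff i (Finset.mem_range.mp hi).le]
    field_simp
    ring
  have hhigh := sum_mem_of_forall (p := p) (r := 1) (n := p - 1)
    (f := fun i => (catalanPoly (genHarmonic 2) p).coeff (p + i) * ((p : ℚ) + (i + 1))⁻¹)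
    fun i hi => mul_mem_right (coeff_catalanPoly_genHarmonic_two_mem hp hp3 (by omega))
      (inv_prime_add_succ_mem hp hi)
  have hc : ((p - 1 : ℕ) : ℚ) + 1 = p := by exact_mod_cast (by omega)
  rw [integ_catalanPoly_eq hp, hlow, hcoeff (p - 1) le_rfl, hc,
    Even.neg_one_pow (show Even (p - 1) from ⟨h, by omega⟩)]
  refine of_eq (pow_mul_mem 3 hhigh) ?_
  simp only [div_eq_mul_inv ((catalanPoly (genHarmonic 2) p).coeff _)]
  field_simp
  ring

end Assembly

theorem theorem2 (p : ℕ) (hp : p.Prime) (hp3 : 3 < p) :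
    RatModEq (p ^ 4)
      (∑ k ∈ Finset.Icc 1 (p - 1), (delannoyNumber k : ℚ) * schroderNumber k)
      (2 * (p : ℚ) ^ 3 * bernoulli (p - 3) - 2 * (p : ℚ) * altHarmonic (p - 1)) ∧
    (RatModEq (p ^ 4)
        (∑ k ∈ Finset.Icc 1 (p - 1), (delannoyNumber k : ℚ) * schroderNumber k)
        (2 * (p : ℚ) ^ 3 * bernoulli (p - 3) - 2 * (p : ℚ) * altHarmonic (p - 1)) ↔
      RatModEq (p ^ 4)
        (∑ k ∈ Finset.Icc 1 (p - 1), (delannoyNumber k : ℚ) * schroderNumber k)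
        (-2 * (p : ℚ) * ∑ k ∈ Finset.Icc 1 (p - 1), ((-1 : ℚ) ^ k + 3) / (k : ℚ))) := by
  have hIcc : ∀ f : ℕ → ℚ, ∑ k ∈ Finset.Icc 1 (p - 1), f k =
      ∑ i ∈ Finset.range (p - 1), f (i + 1) := by
    intro f
    rw [Finset.range_eq_Ico, Finset.sum_Ico_add' f 0 (p - 1) 1]
    rfl
  have hA : altHarmonic (p - 1) = altGenHarmonic 1 (p - 1) := by
    rw [altHarmonic, hIcc, altGenHarmonic]
    simp
  have hS : ∑ k ∈ Finset.Icc 1 (p - 1), (delannoyNumber k : ℚ) * schroderNumber k =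
      ∑ n ∈ Finset.range p, (delannoyNumber n : ℚ) * schroderNumber n - 1 := by
    conv_rhs => rw [show p = p - 1 + 1 by omega, Finset.sum_range_succ']
    rw [hIcc]
    simp [delannoyNumber, schroderNumber]
  have hR : ∑ k ∈ Finset.Icc 1 (p - 1), ((-1 : ℚ) ^ k + 3) / (k : ℚ) =
      altGenHarmonic 1 (p - 1) + 3 * genHarmonic 1 (p - 1) := by
    rw [hIcc, altGenHarmonic, genHarmonic, Finset.mul_sum, ← Finset.sum_add_distrib]
    refine Finset.sum_congr rfl fun i _ => ?_
    push_cast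
    ring
  have hB := padicBall.pow_mul_mem 2 (three_mul_genHarmonic_two_sub_bernoulli_mem hp hp3)
  have hH := padicBall.self_mul_mem (two_mul_genHarmonic_one_add_mem hp hp3)
  have hmain : (∑ n ∈ Finset.range p, (delannoyNumber n : ℚ) * schroderNumber n - 1) -
      (2 * (p : ℚ) ^ 3 * bernoulli (p - 3) - 2 * (p : ℚ) * altGenHarmonic 1 (p - 1)) ∈
      padicBall p 4 := by
    have h1 := sum_delannoy_mul_schroder_sub_mem hp
    have h2 := mul_integ_catalanPoly_one_sub_mem hp hp3
    have h3 := pow_mul_integ_catalanPoly_genHarmonic_mem hp hp3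
    have h4 := padicBall.mul_mem_left (padicBall.ofNat_mem 4)
      (padicBall.pow_mul_mem 3 (alt_double_sum_mem hp hp3))
    have h5 := padicBall.mul_mem_left (padicBall.ofNat_mem 3)
      (padicBall.pow_mul_mem 2 (altGenHarmonic_two_add_mem hp hp3))
    have h6 := padicBall.mul_mem_left (padicBall.ofNat_mem 2)
      (padicBall.pow_mul_mem 2 (four_mul_altGenHarmonic_three_add_mem hp hp3))
    refine padicBall.of_eq (add_mem (add_mem (sub_mem (add_mem (add_mem (sub_mem
      (add_mem h1 h2) h3) h4) h5) h6) hH) hB) ?_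
    change _ = _ + _ - _ + 4 * _ + 3 * _ - 2 * _ + _ + _
    ring
  have hdiff : (2 * (p : ℚ) ^ 3 * bernoulli (p - 3) - 2 * (p : ℚ) * altGenHarmonic 1 (p - 1)) -
      -2 * (p : ℚ) * (altGenHarmonic 1 (p - 1) + 3 * genHarmonic 1 (p - 1)) ∈ padicBall p 4 := by
    have h3 := padicBall.mul_mem_left (padicBall.ofNat_mem 3) hH
    refine padicBall.of_eq (sub_mem h3 hB) ?_
    change _ = 3 * _ - _
    ring
  rw [ratModEq_pow_iff (by norm_num), ratModEq_pow_iff (by norm_num), hS, hA, hR]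
  refine ⟨hmain, fun h => ?_, fun h => ?_⟩
  · exact padicBall.of_eq (add_mem h hdiff) (by ring)
  · exact padicBall.of_eq (sub_mem h hdiff) (by ring)
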